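/- **Setting.** Let $G$ be a finite simple graph. An arc $e=(o(e),t(e))$ is an oriented edge, $e^{-1}$ is its reversal, and $d_v$ is the degree of $v$. For arcs $f,e$ put $$w(f,e)=\begin{cases}2/d_{t(f)} & t(f)=o(e),\ f\ne e^{-1},\\ 2/d_{t(f)}-1 & f=e^{-1},\\ 0&\text{otherwise}\end{cases}$$ (the entries of the Grover matrix of $G$). For a vertex $x_0$, an $x_0$-cycle of length $r\ge1$ is a sequence of arcs $C=(e_1,\dots,e_r)$ with $o(e_1)=x_0=t(e_r)$ and $t(e_i)=o(e_{i+1})$ for $1\le i<r$ (backtracking is allowed). Put $w(C)=w(e_1,e_2)\cdots w(e_{r-1},e_r)\,w(e_r,e_1)$, let $N^0_r$ be the sum of $w(C)$ over all $x_0$-cycles of length $r$, and define $$\overline\zeta_G(u)=\exp\Bigl(\sum_{r\ge1}\frac{N^0_r}{r}u^r\Bigr).$$ Let $\mathbf P$ be the transition operator of the simple random walk, $P_{vw}=1/d_v$ if $v\sim w$ and $0$ otherwise, and let $\Delta=\mathbf D-\mathbf A$ be the Laplacian (degree minus adjacency operator). **Statement.** Let $q\ge0$ be an integer and let $(G_n)$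 be a sequence of finite vertex-transitive $(q+1)$-regular graphs with $|V(G_n)|\to\infty$, each with an arbitrary base vertex $x_n$. Then for every $u\in\mathbb C$ with $|u|<1$ the series defining $\overline\zeta_{G_n}(u)$ converges for every $n$. Moreover, for all $u\in\mathbb C$ with $|u|<1$, with principal values of the logarithm and of the power: 1. If $\mu_P$ is a probability measure on $\mathbb R$ that is the weak limit of the spectral measures (normalized eigenvalue counting measures, with multiplicity) of $\mathbf P(G_n)$, then $\log\{(1+u^2)-2u\lambda\}$ is $\mu_P$-integrable and $$\lim_{n\to\infty}\overline\zeta_{G_n}(u)^{-1}=(1-u^2)^{(q-1)/2}\exp\Bigl[\int\log\{(1+u^2)-2u\lambda\}\,d\mu_P(\lambda)\Bigr].$$ 2. If $\mu_\Delta$ is a probability measure on $\mathbb R$ that is the weak limit of the spectral measures (normalized eigenvalue counting measures, with multiplicity) of $\Delta(G_n)$, then $\log\{(1-2u+u^2)+\frac{2u}{q+1}\lambda\}$ is $\mu_\Delta$-integrable and $$\lim_{n\to\infty}\overline\zeta_{G_n}(u)^{-1}=(1-u^2)^{(q-1)/2}\exp\Bigl[\int\log\Bigl\{(1-2u+u^2)+\frac{2u}{q+1}\lambda\Bigr\}\,d\mu_\Delta(\lambda)\Bigr].$$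 3. If $(G_n,x_n)$ converges locally to a rooted $(q+1)$-regular graph $(H,y)$, i.e. for every $r$ the balls of radius $r$ around $x_n$ and $y$ are isomorphic as rooted graphs for all large $n$, then both logarithms are integrable and both limit formulas hold with $\mu_P$ and $\mu_\Delta$ the spectral measures, at the indicator function $\delta_y$ of the root, of the bounded self-adjoint operators $\mathbf P(H)$ and $\Delta(H)$ on $\ell^2(V(H))$. -/

import Mathlib

open Filter Topology MeasureTheory

noncomputable section

namespace GroverZeta

/-! Weights of arcs, cycles and zeta functions of a finite graph. An arc is a `SimpleGraph.Dart`;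
its origin is `e.fst`, its terminus is `e.snd` and its inverse is `e.symm`. -/

section Finite

variable {V : Type*} [Fintype V] [DecidableEq V] (G : SimpleGraph V) [DecidableRel G.Adj]

/-- The weight `w(f, e)` of a pair of arcs, i.e. the entry in row `e` and column `f` of the
generalized Grover matrix with parameters `a, b`. -/
def weight (a b : ℝ) (f e : G.Dart) : ℝ :=
  if f = e.symm then (2 / (G.degree f.snd : ℝ) - 1) * a
  else if f.snd = e.fst then (2 / (G.degree f.snd : ℝ) - 1) * a + b
  else 0

/-- The sequence of arcs `C 0, …, C k` is an `x`-cycle (of length `k + 1`): consecutive arcs fit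
together, the first one starts at `x` and the last one ends at `x`. Backtracking is allowed. -/
def IsCycleAt (x : V) {k : ℕ} (C : Fin (k + 1) → G.Dart) : Prop :=
  (∀ i : Fin k, (C i.castSucc).snd = (C i.succ).fst) ∧
    (C 0).fst = x ∧ (C (Fin.last k)).snd = x

/-- The weight `w(C) = w(e₁, e₂) ⋯ w(eᵣ₋₁, eᵣ) w(eᵣ, e₁)` of a cycle of length `r = k + 1`. -/
def cycleWeight (a b : ℝ) {k : ℕ} (C : Fin (k + 1) → G.Dart) : ℝ :=
  (∏ i : Fin k, weight G a b (C i.castSucc) (C i.succ)) * weight G a b (C (Fin.last k)) (C 0)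

open scoped Classical in
/-- The sum of the weights of all `x`-cycles of length `k + 1`. -/
def cycleSum (a b : ℝ) (x : V) (k : ℕ) : ℝ :=
  ∑ C : Fin (k + 1) → G.Dart, if IsCycleAt G x C then cycleWeight G a b C else 0

/-- The term of degree `r = k + 1` of the power series in the exponent of the zeta function. -/
def zetaTerm (a b : ℝ) (x : V) (u : ℂ) (k : ℕ) : ℂ :=
  ((cycleSum G a b x k : ℝ) : ℂ) / ((k : ℂ) + 1) * u ^ (k + 1)

/-- The generalized `(a, b)`-zeta function with base vertex `x`,
`exp (∑_{r ≥ 1} N⁰_r / r * u ^ r)`. -/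
def abZeta (a b : ℝ) (x : V) (u : ℂ) : ℂ :=
  Complex.exp (∑' k : ℕ, zetaTerm G a b x u k)

/-- The generalized zeta function of the Grover walk: the case `a = b = 1`. -/
def zeta (x : V) (u : ℂ) : ℂ :=
  abZeta G 1 1 x u

/-- The transition matrix of the simple random walk. -/
def transitionMatrix : Matrix V V ℝ :=
  Matrix.of fun v w => if G.Adj v w then 1 / (G.degree v : ℝ) else 0

/-- The normalized counting measure of the real eigenvalues (with algebraic multiplicity) of a
real square matrix. -/
def eigenvalueMeasure (M : Matrix V V ℝ) : Measure ℝ :=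
  (Fintype.card V : ENNReal)⁻¹ • (M.charpoly.roots.map Measure.dirac).sum

end Finite

/-- Weak convergence of a sequence of measures on the line. -/
def WeaklyTendsto (μs : ℕ → Measure ℝ) (μ : Measure ℝ) : Prop :=
  ∀ f : BoundedContinuousFunction ℝ ℝ,
    Tendsto (fun n => ∫ t, f t ∂(μs n)) atTop (𝓝 (∫ t, f t ∂μ))

/-- Any two vertices are exchanged by an automorphism. -/
def IsVertexTransitive {V : Type*} (G : SimpleGraph V) : Prop :=
  ∀ v w : V, ∃ φ : G ≃g G, φ v = w

/-- The subgraphs induced on the vertices at distance less than `r` from `x` and `y` are isomorphic as rooted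
graphs. -/
def BallsIso {V W : Type*} (G : SimpleGraph V) (x : V) (H : SimpleGraph W) (y : W) (r : ℕ) :
    Prop :=
  ∃ φ : G.induce (G.ball x (r : ℕ∞)) ≃g H.induce (H.ball y (r : ℕ∞)),
    ∀ v, (φ v : W) = y ↔ (v : V) = x

/-- Local convergence of the rooted graphs `(G n, x n)` to the rooted graph `(H, y)`: every ball
around the root is eventually that of the limit. -/
def LocallyTendsto {V : ℕ → Type*} (G : ∀ n, SimpleGraph (V n)) (x : ∀ n, V n)
    {W : Type*} (H : SimpleGraph W) (y : W) : Prop :=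
  ∀ r : ℕ, ∀ᶠ n in atTop, BallsIso (G n) (x n) H y r

/-! The spectral measure of a bounded self-adjoint operator at a vector. -/

section SpectralMeasure

variable {E : Type*} [NormedAddCommGroup E] [InnerProductSpace ℂ E] [CompleteSpace E]

/-- The positive linear functional `f ↦ ⟨v, f(T) v⟩`, with `f(T)` given by the continuous
functional calculus of the self-adjoint operator `T`. -/
def spectralFunctional (T : E →L[ℂ] E) (v : E) :
    CompactlySupportedContinuousMap ℝ ℝ →ₚ[ℝ] ℝ :=
  PositiveLinearMap.mk₀
    { toFun := fun f => (inner ℂ v (cfc (fun t : ℝ => f t) T v)).re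
      map_add' := by
        intro f g
        have h : cfc (fun t : ℝ => (f + g) t) T
            = cfc (fun t : ℝ => f t) T + cfc (fun t : ℝ => g t) T :=
          cfc_add (a := T) (fun t : ℝ => f t) (fun t : ℝ => g t)
            f.continuous.continuousOn g.continuous.continuousOn
        rw [h, add_apply, inner_add_right, Complex.add_re]
      map_smul' := by
        intro c f
        have h : cfc (fun t : ℝ => (c • f) t) T = c • cfc (fun t : ℝ => f t) T :=
          cfc_smul c (fun t : ℝ => f t) T f.continuous.continuousOn
        rw [h, smul_apply, ← Complex.coe_smul, inner_smul_right]
        simp }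
    (by
      intro f hf
      have h : (0 : E →L[ℂ] E) ≤ cfc (fun t : ℝ => f t) T := cfc_nonneg fun t _ => hf t
      have h2 := (ContinuousLinearMap.nonneg_iff_isPositive _).1 h
      exact (Complex.nonneg_iff.1 (h2.inner_nonneg_right v)).1)

/-- The spectral measure of the self-adjoint operator `T` at the vector `v`: the measure `μ` with
`∫ f dμ = ⟨v, f(T) v⟩` for all compactly supported continuous functions `f`. -/
def spectralMeasure (T : E →L[ℂ] E) (v : E) : Measure ℝ :=
  RealRMK.rieszMeasure (spectralFunctional T v)

end SpectralMeasure

/-! The transition operator and the Laplacian on the square summable functions on the vertices of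
a (finite or infinite) regular graph. -/

section Operators

variable {W : Type*} (H : SimpleGraph W) [H.LocallyFinite]

/-- The Hilbert space of square summable complex functions on the vertices. -/
abbrev L2 (W : Type*) : Type _ := lp (fun _ : W => ℂ) 2

/-- The adjacency operator on functions. -/
def adjFun (f : W → ℂ) (v : W) : ℂ := ∑ w ∈ H.neighborFinset v, f w

theorem sum_sq_adjFun_le {d : ℕ} (hd : H.IsRegularOfDegree d) (f : L2 W) (s : Finset W) :
    ∑ v ∈ s, ‖adjFun H f v‖ ^ (2 : ENNReal).toReal
      ≤ ((d : ℝ) * ‖f‖) ^ (2 : ENNReal).toReal := by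
  classical
  have h2 : (2 : ENNReal).toReal = ((2 : ℕ) : ℝ) := by simp
  simp only [h2, Real.rpow_natCast]
  have hpt : ∀ v, ‖adjFun H f v‖ ^ 2 ≤ (d : ℝ) * ∑ w ∈ H.neighborFinset v, ‖f w‖ ^ 2 := by
    intro v
    have h1 : ‖adjFun H f v‖ ≤ ∑ w ∈ H.neighborFinset v, ‖f w‖ := norm_sum_le _ _
    calc ‖adjFun H f v‖ ^ 2 ≤ (∑ w ∈ H.neighborFinset v, ‖f w‖) ^ 2 := by gcongr
      _ ≤ ((H.neighborFinset v).card : ℝ) * ∑ w ∈ H.neighborFinset v, ‖f w‖ ^ 2 :=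
        sq_sum_le_card_mul_sum_sq
      _ = (d : ℝ) * ∑ w ∈ H.neighborFinset v, ‖f w‖ ^ 2 := by
        rw [SimpleGraph.card_neighborFinset_eq_degree, hd.degree_eq v]
  have hfs : ∀ t : Finset W, ∑ w ∈ t, ‖f w‖ ^ 2 ≤ ‖f‖ ^ 2 := by
    intro t
    have := lp.sum_rpow_le_norm_rpow (p := 2) (by simp) f t
    simpa only [h2, Real.rpow_natCast] using this
  have hsum : ∑ v ∈ s, ∑ w ∈ H.neighborFinset v, ‖f w‖ ^ 2 ≤ (d : ℝ) * ‖f‖ ^ 2 := by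
    set t : Finset W := s.biUnion fun v => H.neighborFinset v with ht
    have hcomm : ∑ v ∈ s, ∑ w ∈ H.neighborFinset v, ‖f w‖ ^ 2
        = ∑ w ∈ t, ∑ v ∈ s.filter (fun v => H.Adj w v), ‖f w‖ ^ 2 := by
      apply Finset.sum_comm'
      intro v w
      simp only [ht, Finset.mem_filter, Finset.mem_biUnion, SimpleGraph.mem_neighborFinset]
      constructor
      · rintro ⟨hv, hw⟩
        exact ⟨⟨hv, hw.symm⟩, v, hv, hw⟩
      · rintro ⟨⟨hv, hw⟩, -⟩
        exact ⟨hv, hw.symm⟩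
    rw [hcomm]
    calc ∑ w ∈ t, ∑ v ∈ s.filter (fun v => H.Adj w v), ‖f w‖ ^ 2
        ≤ ∑ w ∈ t, (d : ℝ) * ‖f w‖ ^ 2 := by
          apply Finset.sum_le_sum
          intro w _
          rw [Finset.sum_const, nsmul_eq_mul]
          gcongr
          rw [← hd.degree_eq w, ← SimpleGraph.card_neighborFinset_eq_degree]
          apply Finset.card_le_card
          intro v hv
          simpa using (Finset.mem_filter.1 hv).2
      _ = (d : ℝ) * ∑ w ∈ t, ‖f w‖ ^ 2 := by rw [Finset.mul_sum]
      _ ≤ (d : ℝ) * ‖f‖ ^ 2 := by gcongr; exact hfs t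
  calc ∑ v ∈ s, ‖adjFun H f v‖ ^ 2
      ≤ ∑ v ∈ s, (d : ℝ) * ∑ w ∈ H.neighborFinset v, ‖f w‖ ^ 2 :=
        Finset.sum_le_sum fun v _ => hpt v
    _ = (d : ℝ) * ∑ v ∈ s, ∑ w ∈ H.neighborFinset v, ‖f w‖ ^ 2 := by rw [Finset.mul_sum]
    _ ≤ (d : ℝ) * ((d : ℝ) * ‖f‖ ^ 2) := by gcongr
    _ = ((d : ℝ) * ‖f‖) ^ 2 := by ring

/-- The adjacency operator on the square summable functions, `(A f)(v) = ∑_{w ∼ v} f(w)`. -/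
def adjOp {d : ℕ} (hd : H.IsRegularOfDegree d) : L2 W →L[ℂ] L2 W :=
  LinearMap.mkContinuous
    { toFun := fun f => ⟨fun v => adjFun H f v, memℓp_gen' fun s => sum_sq_adjFun_le H hd f s⟩
      map_add' := by
        intro f g
        ext v
        exact Finset.sum_add_distrib
      map_smul' := by
        intro c f
        ext v
        simp [adjFun, Finset.mul_sum] }
    (d : ℝ)
    (by
      intro f
      exact lp.norm_le_of_forall_sum_le (by simp) (by positivity)
        fun s => sum_sq_adjFun_le H hd f s)

/-- The transition operator `P = d⁻¹ A` of the simple random walk on a `d`-regular graph. -/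
def transitionOp {d : ℕ} (hd : H.IsRegularOfDegree d) : L2 W →L[ℂ] L2 W :=
  ((d : ℂ)⁻¹) • adjOp H hd

/-- The Laplacian `Δ = D - A = d I - A` of a `d`-regular graph. -/
def laplacianOp {d : ℕ} (hd : H.IsRegularOfDegree d) : L2 W →L[ℂ] L2 W :=
  (d : ℂ) • ContinuousLinearMap.id ℂ (L2 W) - adjOp H hd

open scoped Classical in
/-- The indicator function of the vertex `y`, as a square summable function. -/
def delta (y : W) : L2 W := lp.single 2 y (1 : ℂ)

end Operators

/-- The integrand in terms of the transition operator. -/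
def logP (u : ℂ) (t : ℝ) : ℂ := Complex.log ((1 + u ^ 2) - 2 * u * (t : ℂ))

/-- The integrand in terms of the Laplacian of a `(q + 1)`-regular graph. -/
def logDelta (q : ℕ) (u : ℂ) (t : ℝ) : ℂ :=
  Complex.log ((1 - 2 * u + u ^ 2) + 2 * u / ((q : ℂ) + 1) * (t : ℂ))

end GroverZeta

end

/-! Everything reduces to Chebyshev moments of the random walk operator P. The Grover matrix W of a
d-regular graph, d = q + 1, is (2/d)AB − J, where A is the arc-terminus incidence matrix, B the
transposed arc-origin one and J arc reversal. The ranges of A and of the origin matrix span a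
W-invariant space on which powers of W are Chebyshev polynomials in P. This gives tr Wʳ = 2 tr
T_r(P) + |V|(d−2)/2·(1+(−1)ʳ) (`trace_groverMatrix_pow`). Summed over base points, the cycle weights
of length r give tr Wʳ, and vertex transitivity makes them independent of the base point, so N⁰_r is
the trace divided by |V| (`cycleSum_eq`).

With t = cos θ, factoring 1+u²−2ut = (1−ue^{iθ})(1−ue^{−iθ}) gives −log(1+u²−2ut) = ∑ 2T_r(t)uʳ/r
for |u| < 1, |t| ≤ 1. The parity term sums to −((q−1)/2) log(1−u²). Since |T_r| ≤ 1 on [−1,1], all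
these series have a geometric majorant uniform in n, so convergence of each Chebyshev moment implies
convergence of the zeta functions (`tendsto_inv_exp_tsum`).

The moments converge in both settings. For weak limits, Gershgorin's theorem confines the spectrum
of P to [−1,1], and polynomials become admissible test functions. For local limits, the r-th moment
counts closed walks of length at most r at the root, hence is eventually equal to that of the limit
graph. The Laplacian case is the same argument pushed forward along P = 1 − Δ/(q+1). -/

noncomputable section

namespace GroverZeta

/-! ### Traces of powers of the Grover matrix -/

section MatrixAlgebra

open Matrix Polynomial

variable {D V : Type*} [Fintype D] [DecidableEq D] [Fintype V] [DecidableEq V]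

/-- Powers of a Grover type matrix act on the vertex space through Chebyshev polynomials. -/
theorem grover_pow_mul {A A' : Matrix D V ℝ} {B : Matrix V D ℝ} {J : Matrix D D ℝ}
    {P : Matrix V V ℝ} {d : ℝ} (hd : d ≠ 0) (hJA : J * A = A') (hJA' : J * A' = A)
    (hBA : B * A = d • P) (hBA' : B * A' = d • (1 : Matrix V V ℝ)) (r : ℕ) :
    ((2 / d) • (A * B) - J) ^ r * A' =
      A * aeval P (Chebyshev.U ℝ ((r : ℤ) - 1)) - A' * aeval P (Chebyshev.U ℝ ((r : ℤ) - 2)) := by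
  induction r with
  | zero => simp
  | succ r ih =>
    have h1 : ((2 / d) • (A * B) - J) * A = A * P + A * P - A' := by
      rw [Matrix.sub_mul, Matrix.smul_mul, Matrix.mul_assoc, hBA, hJA, Matrix.mul_smul, smul_smul,
        div_mul_cancel₀ _ hd, two_smul]
    have h2 : ((2 / d) • (A * B) - J) * A' = A := by
      rw [Matrix.sub_mul, Matrix.smul_mul, Matrix.mul_assoc, hBA', hJA', Matrix.mul_smul, smul_smul,
        div_mul_cancel₀ _ hd, Matrix.mul_one, two_smul, add_sub_cancel_right]
    have hU : Chebyshev.U ℝ (((r + 1 : ℕ) : ℤ) - 1) =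
        X * Chebyshev.U ℝ ((r : ℤ) - 1) + X * Chebyshev.U ℝ ((r : ℤ) - 1)
          - Chebyshev.U ℝ ((r : ℤ) - 2) := by
      rw [Chebyshev.U_eq ℝ (((r + 1 : ℕ) : ℤ) - 1)]
      push_cast
      ring_nf
    have hU' : (((r + 1 : ℕ) : ℤ) - 2) = (r : ℤ) - 1 := by push_cast; ring
    rw [pow_succ', Matrix.mul_assoc, ih, Matrix.mul_sub, ← Matrix.mul_assoc, ← Matrix.mul_assoc,
      h1, h2, hU, hU', map_sub, map_add, map_mul, aeval_X, Matrix.sub_mul, Matrix.add_mul,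
      Matrix.mul_sub, Matrix.mul_add, Matrix.mul_assoc]
    abel

/-- The trace of the powers of a Grover type matrix. -/
theorem trace_grover_pow {A A' : Matrix D V ℝ} {B B' : Matrix V D ℝ} {J : Matrix D D ℝ}
    {P : Matrix V V ℝ} {d : ℝ} (hd : d ≠ 0) (hJA : J * A = A') (hJA' : J * A' = A)
    (hBJ : B * J = B') (hJJ : J * J = 1)
    (hBA : B * A = d • P) (hBA' : B * A' = d • (1 : Matrix V V ℝ))
    (hB'A : B' * A = d • (1 : Matrix V V ℝ)) (hB'A' : B' * A' = d • P)
    (hJ : J.trace = 0) (hP : P.trace = 0) (r : ℕ) :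
    (((2 / d) • (A * B) - J) ^ r).trace = 2 * (aeval P (Chebyshev.T ℝ r)).trace
      + ((Fintype.card D : ℝ) - 2 * Fintype.card V) / 2 * (1 + (-1) ^ r) := by
  induction r using Nat.twoStepInduction with
  | zero => simp; ring
  | one =>
    simp [hJ, hP, Matrix.trace_mul_comm A B, hBA]
  | more r ih _ =>
    set W := (2 / d) • (A * B) - J with hW
    -- With this explicit inverse Y, W^(r+2) − W^r = W^(r+1)(W − Y), and J cancels in W − Y. What is
    -- left factors through the vertex space, where cyclicity of the trace applies. Steps of two
    -- leave the parity term unchanged.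
    have hinv : W * ((2 / d) • (A' * B') - J) = 1 := by
      have e1 : A * B * (A' * B') = d • (A * B') := by
        rw [Matrix.mul_assoc, ← Matrix.mul_assoc B, hBA', Matrix.smul_mul, Matrix.one_mul,
          Matrix.mul_smul]
      have e2 : A * B * J = A * B' := by rw [Matrix.mul_assoc, hBJ]
      have e3 : J * (A' * B') = A * B' := by rw [← Matrix.mul_assoc, hJA']
      rw [hW, Matrix.sub_mul, Matrix.mul_sub, Matrix.mul_sub, hJJ, Matrix.smul_mul,
        Matrix.smul_mul, Matrix.mul_smul, Matrix.mul_smul, e1, e2, e3, smul_smul (2 / d) d,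
        div_mul_cancel₀ _ hd]
      module
    have hdiff : W ^ (r + 2) - W ^ r =
        (2 / d) • (W ^ (r + 1) * (A * B) - W ^ (r + 1) * (A' * B')) := by
      have : W ^ r = W ^ (r + 1) * ((2 / d) • (A' * B') - J) := by
        rw [pow_succ, Matrix.mul_assoc, hinv, Matrix.mul_one]
      have hWY : W - ((2 / d) • (A' * B') - J) = (2 / d) • (A * B - A' * B') := by
        rw [hW, sub_sub_sub_cancel_right, smul_sub]
      rw [this, pow_succ W (r + 1), ← Matrix.mul_sub, hWY, Matrix.mul_smul, Matrix.mul_sub]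
    have hWA' := grover_pow_mul (B := B) hd hJA hJA' hBA hBA'
    have hWA : W ^ (r + 1) * A = W ^ (r + 2) * A' := by
      have := hWA' 1
      rw [pow_succ W (r + 1), Matrix.mul_assoc]
      congr 1
      simpa using this.symm
    have t1 : (W ^ (r + 1) * (A * B)).trace = d * (P * aeval P (Chebyshev.U ℝ ((r : ℤ) + 1))
        - aeval P (Chebyshev.U ℝ (r : ℤ))).trace := by
      rw [← Matrix.mul_assoc, Matrix.trace_mul_comm, hWA, hWA', Matrix.mul_sub, ← Matrix.mul_assoc,
        ← Matrix.mul_assoc, hBA, hBA', Matrix.smul_mul, Matrix.smul_mul, Matrix.one_mul, ← smul_sub,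
        Matrix.trace_smul, smul_eq_mul]
      push_cast
      ring_nf
    have t2 : (W ^ (r + 1) * (A' * B')).trace = d * (aeval P (Chebyshev.U ℝ (r : ℤ))
        - P * aeval P (Chebyshev.U ℝ ((r : ℤ) - 1))).trace := by
      rw [← Matrix.mul_assoc, Matrix.trace_mul_comm, hWA', Matrix.mul_sub, ← Matrix.mul_assoc,
        ← Matrix.mul_assoc, hB'A, hB'A', Matrix.smul_mul, Matrix.smul_mul, Matrix.one_mul,
        ← smul_sub, Matrix.trace_smul, smul_eq_mul]
      push_cast
      ring_nf
    -- As U_{r+1} + U_{r−1} = 2X U_r, the left side is −2(1−X²)U_r, which equals T_{r+2} − T_r.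
    have hpoly : X * Chebyshev.U ℝ ((r : ℤ) + 1) - Chebyshev.U ℝ (r : ℤ)
        - (Chebyshev.U ℝ (r : ℤ) - X * Chebyshev.U ℝ ((r : ℤ) - 1))
        = Chebyshev.T ℝ ((r : ℤ) + 2) - Chebyshev.T ℝ (r : ℤ) := by
      have a1 := Chebyshev.U_add_one ℝ (r : ℤ)
      have a2 := Chebyshev.one_sub_X_sq_mul_U_eq_pol_in_T ℝ (r : ℤ)
      have a3 := Chebyshev.T_add_two ℝ (r : ℤ)
      linear_combination X * a1 - 2 * a2 + a3
    have hdt : (W ^ (r + 2)).trace - (W ^ r).trace = 2 * (aeval P (Chebyshev.T ℝ ((r : ℤ) + 2))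
        - aeval P (Chebyshev.T ℝ (r : ℤ))).trace := by
      rw [← Matrix.trace_sub, hdiff, Matrix.trace_smul, Matrix.trace_sub, t1, t2, ← map_sub,
        ← hpoly, smul_eq_mul, ← mul_sub, ← mul_assoc, div_mul_cancel₀ _ hd, ← Matrix.trace_sub]
      simp only [map_sub, map_mul, aeval_X]
    rw [Matrix.trace_sub] at hdt
    push_cast
    rw [pow_add (-1 : ℝ)]
    linear_combination hdt + ih

/-- A sum over sequences of products of entries along the sequence is given by a matrix power. -/
theorem sum_prod_path (W : Matrix D D ℝ) (F : D → D → ℝ) (k : ℕ) :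
    ∑ C : Fin (k + 1) → D, (∏ i : Fin k, W (C i.castSucc) (C i.succ)) * F (C (Fin.last k)) (C 0)
      = ∑ a, ∑ b, (W ^ k) a b * F b a := by
  -- Peeling off the first arc a replaces the closing factor by `W a c * F b a`, so `F` must vary.
  induction k generalizing F with
  | zero =>
    rw [← (Equiv.funUnique (Fin 1) D).symm.sum_comp]
    simp [Matrix.one_apply]
  | succ k ih =>
    rw [← (Fin.consEquiv fun _ : Fin (k + 2) => D).sum_comp, Fintype.sum_prod_type]
    calc _ = ∑ a, ∑ C : Fin (k + 1) → D, (∏ i : Fin k, W (C i.castSucc) (C i.succ)) *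
          (fun b c => W a c * F b a) (C (Fin.last k)) (C 0) := by
            refine Finset.sum_congr rfl fun a _ => Finset.sum_congr rfl fun C _ => ?_
            change (∏ i : Fin (k + 1), W ((Fin.cons a C : Fin (k + 2) → D) i.castSucc)
              ((Fin.cons a C : Fin (k + 2) → D) i.succ)) *
                F ((Fin.cons a C : Fin (k + 2) → D) (Fin.last (k + 1)))
                  ((Fin.cons a C : Fin (k + 2) → D) 0) = _
            simp only [Fin.prod_univ_succ, Fin.castSucc_zero,
              Fin.cons_zero, Fin.cons_succ, ← Fin.succ_castSucc, ← Fin.succ_last]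
            ring
      _ = ∑ a, ∑ b, ∑ c, (W ^ k) b c * (W a b * F c a) := by
            exact Finset.sum_congr rfl fun a _ => ih fun b c => W a c * F b a
      _ = _ := by
            refine Finset.sum_congr rfl fun a _ => ?_
            rw [Finset.sum_comm]
            refine Finset.sum_congr rfl fun b _ => ?_
            rw [pow_succ', Matrix.mul_apply, Finset.sum_mul]
            exact Finset.sum_congr rfl fun c _ => by ring

end MatrixAlgebra

/-! ### The Grover matrix of a regular graph -/

section Grover

open Matrix Polynomial

theorem dart_eq_symm_iff {V : Type*} {G : SimpleGraph V} {f e : G.Dart} :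
    f = e.symm ↔ e = f.symm :=
  ⟨fun h => by rw [h, SimpleGraph.Dart.symm_symm], fun h => by rw [h, SimpleGraph.Dart.symm_symm]⟩

/-- The permutation matrix of the reversal of arcs. -/
def flipMatrix {V : Type*} [DecidableEq V] (G : SimpleGraph V) : Matrix G.Dart G.Dart ℝ :=
  Matrix.of fun f e => if f = e.symm then 1 else 0

theorem transpose_flipMatrix {V : Type*} [DecidableEq V] (G : SimpleGraph V) :
    (flipMatrix G)ᵀ = flipMatrix G := by
  ext f e
  simp [flipMatrix, dart_eq_symm_iff (f := e) (e := f)]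

theorem adjMatrix_eq_smul_transitionMatrix {V : Type*} [Fintype V] (G : SimpleGraph V)
    [DecidableRel G.Adj] {d : ℕ} (hd : G.IsRegularOfDegree d) (h0 : d ≠ 0) :
    G.adjMatrix ℝ = (d : ℝ) • transitionMatrix G := by
  ext v w
  by_cases h : G.Adj v w <;> simp [transitionMatrix, hd.degree_eq, h, h0]

variable {V : Type*} [Fintype V] [DecidableEq V] (G : SimpleGraph V) [DecidableRel G.Adj]

/-- The matrix of the weights `w(f, e)` of the Grover walk. -/
def groverMatrix : Matrix G.Dart G.Dart ℝ := Matrix.of fun f e => weight G 1 1 f e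

/-- The incidence matrix of arcs and their termini. -/
def inMatrix : Matrix G.Dart V ℝ := Matrix.of fun f v => if f.snd = v then 1 else 0

/-- The incidence matrix of arcs and their origins. -/
def outMatrix : Matrix G.Dart V ℝ := Matrix.of fun f v => if f.fst = v then 1 else 0

theorem flipMatrix_mul {ι : Type*} (M : Matrix G.Dart ι ℝ) :
    flipMatrix G * M = Matrix.of fun f i => M f.symm i := by
  ext f i
  simp [Matrix.mul_apply, flipMatrix, dart_eq_symm_iff]

theorem flipMatrix_mul_self : flipMatrix G * flipMatrix G = 1 := by
  rw [flipMatrix_mul]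
  ext f e
  simp [flipMatrix, Matrix.one_apply, SimpleGraph.Dart.symm_involutive.injective.eq_iff]

theorem flipMatrix_mul_inMatrix : flipMatrix G * inMatrix G = outMatrix G := by
  rw [flipMatrix_mul]; rfl

theorem flipMatrix_mul_outMatrix : flipMatrix G * outMatrix G = inMatrix G := by
  rw [flipMatrix_mul]; rfl

theorem trace_flipMatrix : (flipMatrix G).trace = 0 := by
  simp [Matrix.trace, flipMatrix, (SimpleGraph.Dart.symm_ne _).symm]

theorem outMatrix_transpose_mul_inMatrix : (outMatrix G)ᵀ * inMatrix G = G.adjMatrix ℝ := by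
  ext v w
  simp only [Matrix.mul_apply, Matrix.transpose_apply, outMatrix, inMatrix, Matrix.of_apply,
    SimpleGraph.adjMatrix_apply, mul_ite, mul_one, mul_zero, ← ite_and]
  split_ifs with h
  · rw [Finset.sum_eq_single_of_mem (⟨(v, w), h⟩ : G.Dart) (Finset.mem_univ _)]
    · simp
    · rintro ⟨⟨a, b⟩, hab⟩ - hne
      rw [if_neg]
      rintro ⟨rfl, rfl⟩
      exact hne rfl
  · refine Finset.sum_eq_zero fun e _ => if_neg ?_
    rintro ⟨rfl, rfl⟩
    exact h e.adj

theorem outMatrix_transpose_mul_outMatrix {d : ℕ} (hd : G.IsRegularOfDegree d) :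
    (outMatrix G)ᵀ * outMatrix G = (d : ℝ) • (1 : Matrix V V ℝ) := by
  ext v w
  simp only [Matrix.mul_apply, Matrix.transpose_apply, outMatrix, Matrix.of_apply,
    mul_ite, mul_one, mul_zero, ← ite_and, Matrix.smul_apply, Matrix.one_apply, smul_eq_mul]
  split_ifs with h
  · subst h
    simp only [and_self, Finset.sum_boole, G.dart_fst_fiber_card_eq_degree, hd.degree_eq]
  · refine Finset.sum_eq_zero fun e _ => if_neg ?_
    rintro ⟨rfl, rfl⟩
    exact h rfl

theorem groverMatrix_eq {d : ℕ} (hd : G.IsRegularOfDegree d) :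
    groverMatrix G = (2 / (d : ℝ)) • (inMatrix G * (outMatrix G)ᵀ) - flipMatrix G := by
  ext f e
  have h : (inMatrix G * (outMatrix G)ᵀ) f e = if f.snd = e.fst then 1 else 0 := by
    simp [Matrix.mul_apply, inMatrix, outMatrix, eq_comm]
  rw [Matrix.sub_apply, Matrix.smul_apply, h]
  simp only [groverMatrix, weight, flipMatrix, Matrix.of_apply, hd.degree_eq]
  by_cases h1 : f = e.symm
  · have : f.snd = e.fst := by rw [h1]; rfl
    simp [h1]
  · by_cases h2 : f.snd = e.fst <;> simp [h1, h2]

theorem trace_groverMatrix_pow {d : ℕ} (hd : G.IsRegularOfDegree d) (h0 : d ≠ 0) (r : ℕ) :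
    (groverMatrix G ^ r).trace = 2 * (aeval (transitionMatrix G) (Chebyshev.T ℝ r)).trace
      + (Fintype.card V : ℝ) * (((d : ℝ) - 2) / 2) * (1 + (-1) ^ r) := by
  have h0' : (d : ℝ) ≠ 0 := by exact_mod_cast h0
  have hadj := adjMatrix_eq_smul_transitionMatrix G hd h0
  have hoi := outMatrix_transpose_mul_inMatrix G
  have hio : (inMatrix G)ᵀ * outMatrix G = G.adjMatrix ℝ := by
    rw [← SimpleGraph.transpose_adjMatrix, ← hoi, Matrix.transpose_mul, Matrix.transpose_transpose]
  have hoo := outMatrix_transpose_mul_outMatrix G hd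
  have hii : (inMatrix G)ᵀ * inMatrix G = (d : ℝ) • (1 : Matrix V V ℝ) := by
    rw [← hoo, ← flipMatrix_mul_outMatrix, Matrix.transpose_mul, Matrix.mul_assoc,
      ← Matrix.mul_assoc (flipMatrix G)ᵀ, transpose_flipMatrix, flipMatrix_mul_self, Matrix.one_mul]
  have hof : (outMatrix G)ᵀ * flipMatrix G = (inMatrix G)ᵀ := by
    rw [← flipMatrix_mul_outMatrix, Matrix.transpose_mul, transpose_flipMatrix]
  have hcard : (Fintype.card G.Dart : ℝ) = Fintype.card V * d := by
    rw [G.dart_card_eq_sum_degrees]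
    simp [hd.degree_eq]
  rw [groverMatrix_eq G hd, trace_grover_pow h0' (flipMatrix_mul_inMatrix G)
    (flipMatrix_mul_outMatrix G) hof (flipMatrix_mul_self G) (hoi.trans hadj) hoo hii
    (hio.trans hadj) (trace_flipMatrix G) (by simp [Matrix.trace, transitionMatrix]), hcard]
  ring

/-- A sequence of arcs is a cycle for at most one base point, and one that is a cycle for none
contains a zero weight. The sum therefore runs over all sequences, with no constraint. -/
theorem sum_cycleSum (k : ℕ) :
    ∑ x, cycleSum G 1 1 x k = (groverMatrix G ^ (k + 1)).trace := by
  have h : ∀ C : Fin (k + 1) → G.Dart,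
      ∑ x, (open scoped Classical in if IsCycleAt G x C then cycleWeight G 1 1 C else 0)
        = cycleWeight G 1 1 C := by
    intro C
    by_cases hC : IsCycleAt G (C 0).fst C
    · rw [Finset.sum_eq_single_of_mem (C 0).fst (Finset.mem_univ _), if_pos hC]
      exact fun x _ hx => if_neg fun h => hx h.2.1.symm
    · have hw : ∀ f e : G.Dart, f.snd ≠ e.fst → weight G 1 1 f e = 0 := by
        intro f e hfe
        rw [weight, if_neg, if_neg hfe]
        rintro rfl
        exact hfe rfl
      have h0 : cycleWeight G 1 1 C = 0 := by
        rw [cycleWeight]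
        by_cases h1 : ∀ i : Fin k, (C i.castSucc).snd = (C i.succ).fst
        · rw [hw (C (Fin.last k)) (C 0) fun h2 => hC ⟨h1, rfl, h2⟩, mul_zero]
        · push Not at h1
          obtain ⟨i, hi⟩ := h1
          rw [Finset.prod_eq_zero (Finset.mem_univ i) (hw _ _ hi), zero_mul]
      simp [h0]
  simp only [cycleSum]
  rw [Finset.sum_comm]
  simp only [h]
  simp only [cycleWeight]
  refine (sum_prod_path (groverMatrix G) (fun f e => weight G 1 1 f e) k).trans ?_
  rw [Matrix.trace]
  refine Finset.sum_congr rfl fun a _ => ?_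
  rw [Matrix.diag_apply, pow_succ, Matrix.mul_apply]
  rfl

/-- The bijection of arcs induced by an automorphism. -/
def dartEquiv (φ : G ≃g G) : G.Dart ≃ G.Dart where
  toFun := φ.toHom.mapDart
  invFun := φ.symm.toHom.mapDart
  left_inv e := by
    apply SimpleGraph.Dart.ext
    exact Prod.ext (by simp [SimpleGraph.Hom.mapDart]) (by simp [SimpleGraph.Hom.mapDart])
  right_inv e := by
    apply SimpleGraph.Dart.ext
    exact Prod.ext (by simp [SimpleGraph.Hom.mapDart]) (by simp [SimpleGraph.Hom.mapDart])

/-- An automorphism permutes arcs, respecting incidence, reversal and degrees, hence weights. -/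
theorem cycleSum_map (a b : ℝ) (φ : G ≃g G) (x : V) (k : ℕ) :
    cycleSum G a b (φ x) k = cycleSum G a b x k := by
  have hfst : ∀ e : G.Dart, (dartEquiv G φ e).fst = φ e.fst := fun _ => rfl
  have hsnd : ∀ e : G.Dart, (dartEquiv G φ e).snd = φ e.snd := fun _ => rfl
  have hsymm : ∀ e : G.Dart, (dartEquiv G φ e).symm = dartEquiv G φ e.symm := fun _ => rfl
  have hw : ∀ f e : G.Dart,
      weight G a b (dartEquiv G φ f) (dartEquiv G φ e) = weight G a b f e := by
    intro f e
    have hdeg : G.degree (dartEquiv G φ f).snd = G.degree f.snd := φ.degree_eq f.snd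
    simp only [weight, hdeg]
    simp only [hsymm, hfst, hsnd, (dartEquiv G φ).injective.eq_iff, φ.injective.eq_iff]
  refine (Fintype.sum_equiv ((Equiv.refl (Fin (k + 1))).arrowCongr (dartEquiv G φ)) _ _
    fun C => ?_).symm
  have hC : ∀ i, (Equiv.refl (Fin (k + 1))).arrowCongr (dartEquiv G φ) C i = dartEquiv G φ (C i) :=
    fun _ => rfl
  have h1 : IsCycleAt G (φ x) ((Equiv.refl (Fin (k + 1))).arrowCongr (dartEquiv G φ) C) ↔
      IsCycleAt G x C := by
    simp only [IsCycleAt, hC, hfst, hsnd, φ.injective.eq_iff]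
  have h2 : cycleWeight G a b ((Equiv.refl (Fin (k + 1))).arrowCongr (dartEquiv G φ) C) =
      cycleWeight G a b C := by
    simp only [cycleWeight, hC, hw]
  by_cases h : IsCycleAt G x C
  · rw [if_pos h, if_pos (h1.2 h), h2]
  · rw [if_neg h, if_neg (h1.not.2 h)]

theorem cycleSum_eq {d : ℕ} (hG : IsVertexTransitive G) (hd : G.IsRegularOfDegree d) (h0 : d ≠ 0)
    (x : V) (k : ℕ) :
    cycleSum G 1 1 x k =
      2 * ((aeval (transitionMatrix G) (Chebyshev.T ℝ (k + 1 : ℕ))).trace / Fintype.card V)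
        + ((d : ℝ) - 2) / 2 * (1 + (-1) ^ (k + 1)) := by
  have hsum : ∑ y, cycleSum G 1 1 y k = Fintype.card V * cycleSum G 1 1 x k := by
    rw [Finset.sum_congr rfl fun y _ => ?_, Finset.sum_const, nsmul_eq_mul, Finset.card_univ]
    obtain ⟨φ, rfl⟩ := hG x y
    exact cycleSum_map G 1 1 φ x k
  have hV : (Fintype.card V : ℝ) ≠ 0 := by
    have : Nonempty V := ⟨x⟩
    exact_mod_cast Fintype.card_ne_zero
  rw [sum_cycleSum, trace_groverMatrix_pow G hd h0] at hsum
  field_simp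
  linarith

end Grover

/-! ### Power series of the logarithms -/

section Logarithm

open Polynomial

/-- Both factors lie in the open right half-plane, so their arguments add up inside (−π, π) and no
branch is crossed. -/
theorem log_one_sub_mul {z w : ℂ} (hz : ‖z‖ < 1) (hw : ‖w‖ < 1) :
    Complex.log ((1 - z) * (1 - w)) = Complex.log (1 - z) + Complex.log (1 - w) := by
  have hre : ∀ {z : ℂ}, ‖z‖ < 1 → 0 < (1 - z).re := by
    intro z hz
    have := (Complex.re_le_norm z).trans_lt hz
    simpa using this
  have harg : ∀ {z : ℂ}, ‖z‖ < 1 → |(1 - z).arg| < Real.pi / 2 :=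
    fun hz => Complex.abs_arg_lt_pi_div_two_iff.2 (Or.inl (hre hz))
  have hne : ∀ {z : ℂ}, ‖z‖ < 1 → 1 - z ≠ 0 := by
    intro z hz h
    have := hre hz
    simp [h] at this
  have h1 := abs_lt.1 (harg hz)
  have h2 := abs_lt.1 (harg hw)
  exact Complex.log_mul (hne hz) (hne hw) ⟨by linarith, by linarith⟩

theorem hasSum_neg_log_one_sub {z : ℂ} (hz : ‖z‖ < 1) :
    HasSum (fun k : ℕ => z ^ (k + 1) / ((k : ℂ) + 1)) (-Complex.log (1 - z)) := by
  simpa using (hasSum_nat_add_iff' 1).2 (Complex.hasSum_taylorSeries_neg_log hz)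

theorem hasSum_neg_logP {u : ℂ} (hu : ‖u‖ < 1) {t : ℝ} (ht : |t| ≤ 1) :
    HasSum (fun k : ℕ => ((2 * (Chebyshev.T ℝ (k + 1 : ℕ)).eval t : ℝ) : ℂ) / ((k : ℂ) + 1)
      * u ^ (k + 1)) (-logP u t) := by
  obtain ⟨θ, rfl⟩ : ∃ θ, Real.cos θ = t :=
    ⟨_, Real.cos_arccos (abs_le.1 ht).1 (abs_le.1 ht).2⟩
  set z : ℂ := Complex.exp (θ * Complex.I) with hz
  set w : ℂ := Complex.exp (-θ * Complex.I) with hw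
  have hzn : ‖u * z‖ < 1 := by
    rw [norm_mul, hz, Complex.norm_exp_ofReal_mul_I, mul_one]
    exact hu
  have hwn : ‖u * w‖ < 1 := by
    rw [norm_mul, hw, ← Complex.ofReal_neg, Complex.norm_exp_ofReal_mul_I, mul_one]
    exact hu
  have hzw : z * w = 1 := by
    rw [hz, hw, ← Complex.exp_add]
    simp
  have hcos : z + w = 2 * Complex.cos θ := by
    rw [Complex.two_cos]
  have hlog : logP u (Real.cos θ) = Complex.log (1 - u * z) + Complex.log (1 - u * w) := by
    rw [← log_one_sub_mul hzn hwn, logP, Complex.ofReal_cos]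
    congr 1
    linear_combination u * hcos - u ^ 2 * hzw
  rw [hlog, neg_add]
  convert (hasSum_neg_log_one_sub hzn).add (hasSum_neg_log_one_sub hwn) using 2 with k
  have hT : ((2 * (Chebyshev.T ℝ (k + 1 : ℕ)).eval (Real.cos θ) : ℝ) : ℂ)
      = z ^ (k + 1) + w ^ (k + 1) := by
    rw [Polynomial.Chebyshev.T_real_cos, hz, hw, ← Complex.exp_nat_mul, ← Complex.exp_nat_mul]
    push_cast
    rw [Complex.two_cos]
    congr 2 <;> ring
  rw [hT, mul_pow, mul_pow]
  ring

theorem hasSum_neg_log_one_sub_sq {u : ℂ} (hu : ‖u‖ < 1) :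
    HasSum (fun k : ℕ => (1 + (-1) ^ (k + 1)) / ((k : ℂ) + 1) * u ^ (k + 1))
      (-Complex.log (1 - u ^ 2)) := by
  have hu' : ‖-u‖ < 1 := by rwa [norm_neg]
  have h : 1 - u ^ 2 = (1 - u) * (1 - -u) := by ring
  rw [h, log_one_sub_mul hu hu', neg_add]
  convert (hasSum_neg_log_one_sub hu).add (hasSum_neg_log_one_sub hu') using 2 with k
  rw [neg_pow u]
  ring

end Logarithm

/-! ### Convergence of moments implies convergence of the zeta functions -/

section Limit

open Polynomial

/-- The term of degree `k + 1` of the logarithm of the zeta function in terms of the Chebyshev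
moments `m` of a spectral measure. -/
def momentTerm (q : ℕ) (m : ℕ → ℝ) (u : ℂ) (k : ℕ) : ℂ :=
  ((2 * m (k + 1) + ((q : ℝ) - 1) / 2 * (1 + (-1) ^ (k + 1)) : ℝ) : ℂ) / ((k : ℂ) + 1)
    * u ^ (k + 1)

theorem norm_momentTerm_le {q : ℕ} {m : ℕ → ℝ} (hm : ∀ r, |m r| ≤ 1) (u : ℂ) (k : ℕ) :
    ‖momentTerm q m u k‖ ≤ (3 + q) * ‖u‖ ^ (k + 1) := by
  have hk : (1 : ℝ) ≤ ‖(k : ℂ) + 1‖ := by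
    have : (k : ℂ) + 1 = ((k + 1 : ℕ) : ℂ) := by push_cast; ring
    rw [this, Complex.norm_natCast]
    push_cast
    linarith [(Nat.cast_nonneg k : (0 : ℝ) ≤ k)]
  rw [momentTerm, norm_mul, norm_pow, norm_div, Complex.norm_real, Real.norm_eq_abs]
  gcongr
  refine (div_le_self (abs_nonneg _) hk).trans ?_
  have h1 : |(1 + (-1) ^ (k + 1) : ℝ)| ≤ 2 := by
    rcases neg_one_pow_eq_or ℝ (k + 1) with h | h <;> rw [h] <;> norm_num
  have h2 : |((q : ℝ) - 1) / 2| ≤ (q + 1) / 2 := by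
    rw [abs_le]
    have := (Nat.cast_nonneg q : (0 : ℝ) ≤ q)
    constructor <;> linarith
  calc _ ≤ |2 * m (k + 1)| + |((q : ℝ) - 1) / 2 * (1 + (-1) ^ (k + 1))| := abs_add_le _ _
    _ ≤ 2 * 1 + (q + 1) / 2 * 2 := by
      rw [abs_mul, abs_mul, abs_two]
      gcongr
      exact hm _
    _ = 3 + q := by ring

theorem summable_const_mul_norm_pow {u : ℂ} (hu : ‖u‖ < 1) (c : ℝ) :
    Summable fun k : ℕ => c * ‖u‖ ^ (k + 1) :=
  ((summable_nat_add_iff 1).2 (summable_geometric_of_lt_one (norm_nonneg u) hu)).mul_left c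

theorem summable_momentTerm {q : ℕ} {m : ℕ → ℝ} (hm : ∀ r, |m r| ≤ 1) {u : ℂ} (hu : ‖u‖ < 1) :
    Summable (momentTerm q m u) :=
  (summable_const_mul_norm_pow hu _).of_norm_bounded (norm_momentTerm_le hm u)

theorem measurable_logP (u : ℂ) : Measurable (logP u) := by
  unfold logP
  fun_prop

variable {μ : Measure ℝ} [IsProbabilityMeasure μ]

theorem norm_logP_term_le {t : ℝ} (ht : |t| ≤ 1) (u : ℂ) (k : ℕ) :
    ‖((2 * (Chebyshev.T ℝ (k + 1 : ℕ)).eval t : ℝ) : ℂ) / ((k : ℂ) + 1) * u ^ (k + 1)‖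
      ≤ 4 * ‖u‖ ^ (k + 1) := by
  -- At q = 1 the parity term vanishes, and 3 + q is the constant 4.
  have := norm_momentTerm_le (q := 1) (m := fun r => (Chebyshev.T ℝ r).eval t)
    (fun r => Chebyshev.abs_eval_T_real_le_one r ht) u k
  norm_num [momentTerm] at this ⊢
  exact this

theorem integrable_logP {u : ℂ} (hu : ‖u‖ < 1) (hμ : ∀ᵐ t ∂μ, |t| ≤ 1) :
    Integrable (logP u) μ := by
  refine Integrable.of_bound (measurable_logP u).aestronglyMeasurable
    (∑' k : ℕ, 4 * ‖u‖ ^ (k + 1)) ?_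
  filter_upwards [hμ] with t ht
  rw [← norm_neg, ← (hasSum_neg_logP hu ht).tsum_eq]
  exact tsum_of_norm_bounded (summable_const_mul_norm_pow hu 4).hasSum (norm_logP_term_le ht u)

theorem hasSum_integral_logP {u : ℂ} (hu : ‖u‖ < 1) (hμ : ∀ᵐ t ∂μ, |t| ≤ 1) :
    HasSum (fun k : ℕ => ((2 * ∫ t, (Chebyshev.T ℝ (k + 1 : ℕ)).eval t ∂μ : ℝ) : ℂ)
      / ((k : ℂ) + 1) * u ^ (k + 1)) (-∫ t, logP u t ∂μ) := by
  have hint : ∀ k : ℕ, Integrable (fun t : ℝ =>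
      ((2 * (Chebyshev.T ℝ (k + 1 : ℕ)).eval t : ℝ) : ℂ) / ((k : ℂ) + 1) * u ^ (k + 1)) μ := by
    intro k
    refine Integrable.of_bound (Continuous.aestronglyMeasurable (by fun_prop))
      (4 * ‖u‖ ^ (k + 1)) ?_
    filter_upwards [hμ] with t ht using norm_logP_term_le ht u k
  have hsum := hasSum_integral_of_summable_integral_norm hint <|
    (summable_const_mul_norm_pow hu 4).of_nonneg_of_le
      (fun k => integral_nonneg fun t => norm_nonneg _) fun k => by
        refine (integral_mono_ae (hint k).norm (integrable_const (4 * ‖u‖ ^ (k + 1))) ?_).trans ?_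
        · filter_upwards [hμ] with t ht using norm_logP_term_le ht u k
        · simp
  have hval : -∫ t, logP u t ∂μ = ∫ t, ∑' k : ℕ,
      ((2 * (Chebyshev.T ℝ (k + 1 : ℕ)).eval t : ℝ) : ℂ) / ((k : ℂ) + 1) * u ^ (k + 1) ∂μ := by
    rw [← integral_neg]
    refine integral_congr_ae ?_
    filter_upwards [hμ] with t ht using (hasSum_neg_logP hu ht).tsum_eq.symm
  rw [hval]
  refine hsum.congr_fun fun k => ?_
  rw [integral_mul_const, integral_div, integral_complex_ofReal, integral_const_mul]

theorem hasSum_momentTerm_integral (q : ℕ) {u : ℂ} (hu : ‖u‖ < 1) (hμ : ∀ᵐ t ∂μ, |t| ≤ 1) :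
    HasSum (momentTerm q (fun r => ∫ t, (Chebyshev.T ℝ r).eval t ∂μ) u)
      (-∫ t, logP u t ∂μ + ((q : ℂ) - 1) / 2 * -Complex.log (1 - u ^ 2)) := by
  refine ((hasSum_integral_logP hu hμ).add
    ((hasSum_neg_log_one_sub_sq hu).mul_left (((q : ℂ) - 1) / 2))).congr_fun fun k => ?_
  simp only [momentTerm]
  push_cast
  ring

/-- Dominated convergence for series: the majorant (3+q)‖u‖^(k+1) does not depend on n, so termwise
convergence of the moments suffices. -/
theorem tendsto_inv_exp_tsum (q : ℕ) {u : ℂ} (hu : ‖u‖ < 1) (hμ : ∀ᵐ t ∂μ, |t| ≤ 1)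
    {m : ℕ → ℕ → ℝ} (hm : ∀ n r, |m n r| ≤ 1)
    (hlim : ∀ r, Tendsto (fun n => m n r) atTop (𝓝 (∫ t, (Chebyshev.T ℝ r).eval t ∂μ))) :
    Tendsto (fun n => (Complex.exp (∑' k, momentTerm q (m n) u k))⁻¹) atTop
      (𝓝 ((1 - u ^ 2) ^ (((q : ℂ) - 1) / 2) * Complex.exp (∫ t, logP u t ∂μ))) := by
  have h0 : 1 - u ^ 2 ≠ 0 := by
    intro h
    have h1 : ‖u ^ 2‖ < 1 := by
      rw [norm_pow]
      exact pow_lt_one₀ (norm_nonneg u) hu two_ne_zero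
    rw [← sub_eq_zero.1 h] at h1
    simp at h1
  have hL : (1 - u ^ 2) ^ (((q : ℂ) - 1) / 2) * Complex.exp (∫ t, logP u t ∂μ) =
      (Complex.exp (∑' k, momentTerm q (fun r => ∫ t, (Chebyshev.T ℝ r).eval t ∂μ) u k))⁻¹ := by
    rw [(hasSum_momentTerm_integral q hu hμ).tsum_eq, ← Complex.exp_neg, Complex.cpow_def_of_ne_zero h0,
      ← Complex.exp_add]
    congr 1
    ring
  rw [hL]
  refine ((Complex.continuous_exp.tendsto _).comp ?_).inv₀ (Complex.exp_ne_zero _)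
  refine tendsto_tsum_of_dominated_convergence (summable_const_mul_norm_pow hu (3 + q)) ?_
    (Eventually.of_forall fun n k => norm_momentTerm_le (hm n) u k)
  intro k
  refine Tendsto.mul_const _ (Tendsto.div_const ?_ _)
  exact (Complex.continuous_ofReal.tendsto _).comp (((hlim (k + 1)).const_mul 2).add_const _)

end Limit

/-! ### Eigenvalue measures and weak limits -/

section Eigenvalue

open Polynomial Matrix

variable {V : Type*} [Fintype V] [DecidableEq V]

theorem eigenvalueMeasure_eq {M : Matrix V V ℝ} (hM : M.IsHermitian) :
    eigenvalueMeasure M =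
      (Fintype.card V : ENNReal)⁻¹ • ∑ i, Measure.dirac (hM.eigenvalues i) := by
  rw [eigenvalueMeasure, hM.roots_charpoly_eq_eigenvalues, Multiset.map_map]
  rfl

theorem integral_eigenvalueMeasure {M : Matrix V V ℝ} (hM : M.IsHermitian) (f : ℝ → ℝ) :
    ∫ t, f t ∂(eigenvalueMeasure M) = (∑ i, f (hM.eigenvalues i)) / Fintype.card V := by
  rw [eigenvalueMeasure_eq hM, integral_smul_measure,
    integral_finsetSum_measure fun i _ => integrable_dirac (by simp)]
  simp [div_eq_inv_mul]

theorem ae_eigenvalueMeasure {M : Matrix V V ℝ} (hM : M.IsHermitian) {p : ℝ → Prop}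
    (hp : ∀ i, p (hM.eigenvalues i)) (hm : MeasurableSet {t | p t}) :
    ∀ᵐ t ∂(eigenvalueMeasure M), p t := by
  rw [eigenvalueMeasure_eq hM]
  refine Measure.ae_smul_measure ?_ _
  rw [← Measure.sum_fintype, Measure.ae_sum_iff' hm]
  exact fun i => (ae_dirac_iff hm).2 (hp i)

theorem trace_aeval {M : Matrix V V ℝ} (hM : M.IsHermitian) (p : ℝ[X]) :
    (aeval M p).trace = ∑ i, p.eval (hM.eigenvalues i) := by
  have hdiag : aeval (diagonal (RCLike.ofReal ∘ hM.eigenvalues : V → ℝ)) p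
      = diagonal fun i => p.eval (hM.eigenvalues i) := by
    have h := aeval_algHom_apply (diagonalAlgHom (n := V) (α := ℝ) ℝ) hM.eigenvalues p
    have h2 : aeval hM.eigenvalues p = fun i => p.eval (hM.eigenvalues i) := by
      ext i
      simp [aeval_fn_apply]
    rw [h2] at h
    exact h
  have hconj := aeval_algHom_apply
    (Unitary.conjStarAlgAut ℝ (Matrix V V ℝ) hM.eigenvectorUnitary).toAlgEquiv.toAlgHom
    (diagonal (RCLike.ofReal ∘ hM.eigenvalues : V → ℝ)) p
  rw [hdiag] at hconj
  have hM' : (Unitary.conjStarAlgAut ℝ (Matrix V V ℝ) hM.eigenvectorUnitary).toAlgEquiv.toAlgHom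
    (diagonal (RCLike.ofReal ∘ hM.eigenvalues : V → ℝ)) = M := hM.spectral_theorem.symm
  rw [hM'] at hconj
  rw [hconj]
  change (Unitary.conjStarAlgAut ℝ (Matrix V V ℝ) hM.eigenvectorUnitary _).trace = _
  rw [Unitary.conjStarAlgAut_apply, Matrix.trace_mul_cycle]
  simp [Matrix.trace]

/-- Gershgorin's circle theorem with all discs centred at c. -/
theorem norm_eigenvalues_sub_le {M : Matrix V V ℝ} (hM : M.IsHermitian) {c r : ℝ}
    (hc : ∀ k, M k k = c) (hr : ∀ k, ∑ j ∈ Finset.univ.erase k, ‖M k j‖ ≤ r) (i : V) :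
    |hM.eigenvalues i - c| ≤ r := by
  have h : Module.End.HasEigenvalue (Matrix.toLin' M) (hM.eigenvalues i) := by
    rw [Module.End.hasEigenvalue_iff_mem_spectrum, Matrix.spectrum_toLin']
    exact hM.eigenvalues_mem_spectrum_real i
  obtain ⟨k, hk⟩ := eigenvalue_mem_ball h
  rw [Metric.mem_closedBall, Real.dist_eq, hc] at hk
  exact hk.trans (hr k)

end Eigenvalue

/-! ### Weak limits of measures carried by [−1, 1] -/

section WeakLimit

variable {νs : ℕ → Measure ℝ} {ν : Measure ℝ}

theorem ae_abs_le_one_of_weaklyTendsto [IsFiniteMeasure ν] (h : WeaklyTendsto νs ν)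
    (hae : ∀ n, ∀ᵐ t ∂(νs n), |t| ≤ 1) : ∀ᵐ t ∂ν, |t| ≤ 1 := by
  -- A bounded test function that vanishes exactly on [−1, 1].
  have hf : Continuous fun t : ℝ => min 1 (max 0 (|t| - 1)) := by fun_prop
  have h0 : ∀ t : ℝ, 0 ≤ min 1 (max 0 (|t| - 1)) := fun t => le_min zero_le_one (le_max_left _ _)
  let f : BoundedContinuousFunction ℝ ℝ :=
    BoundedContinuousFunction.ofNormedAddCommGroup _ hf 1 fun t => by
      rw [Real.norm_eq_abs, abs_of_nonneg (h0 t)]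
      exact min_le_left _ _
  have hz : ∀ n, ∫ t, f t ∂(νs n) = 0 := by
    intro n
    refine integral_eq_zero_of_ae ?_
    filter_upwards [hae n] with t ht
    change min 1 (max 0 (|t| - 1)) = 0
    rw [max_eq_left (by linarith), min_eq_right zero_le_one]
  have hlim := h f
  simp only [hz] at hlim
  have hν : ∫ t, f t ∂ν = 0 := tendsto_nhds_unique hlim tendsto_const_nhds
  have := (integral_eq_zero_iff_of_nonneg (fun t => h0 t) (f.integrable ν)).1 hν
  filter_upwards [this] with t ht
  by_contra! hlt
  have : 0 < min 1 (max 0 (|t| - 1)) := lt_min one_pos (lt_max_of_lt_right (by linarith))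
  exact this.ne' ht

theorem tendsto_integral_of_weaklyTendsto [IsFiniteMeasure ν] (h : WeaklyTendsto νs ν)
    (hae : ∀ n, ∀ᵐ t ∂(νs n), |t| ≤ 1) {p : ℝ → ℝ} (hp : Continuous p) :
    Tendsto (fun n => ∫ t, p t ∂(νs n)) atTop (𝓝 (∫ t, p t ∂ν)) := by
  have h11 : (-1 : ℝ) ≤ 1 := by norm_num
  -- Clamping the argument to [−1, 1] makes p bounded without changing it where the measures live.
  let f : BoundedContinuousFunction ℝ ℝ :=
    (BoundedContinuousFunction.mkOfCompact
      (⟨fun t : Set.Icc (-1 : ℝ) 1 => p t, by fun_prop⟩ : C(Set.Icc (-1 : ℝ) 1, ℝ))).compContinuous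
      ⟨Set.projIcc (-1) 1 h11, continuous_projIcc⟩
  have hf : ∀ t : ℝ, |t| ≤ 1 → f t = p t := by
    intro t ht
    change p (Set.projIcc (-1) 1 h11 t) = p t
    rw [Set.projIcc_of_mem h11 (abs_le.1 ht)]
  have h1 : ∀ n, ∫ t, f t ∂(νs n) = ∫ t, p t ∂(νs n) := fun n =>
    integral_congr_ae ((hae n).mono fun t ht => hf t ht)
  have h2 : ∫ t, f t ∂ν = ∫ t, p t ∂ν :=
    integral_congr_ae ((ae_abs_le_one_of_weaklyTendsto h hae).mono fun t ht => hf t ht)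
  simpa only [h1, h2] using h f

theorem WeaklyTendsto.map (h : WeaklyTendsto νs ν) {g : ℝ → ℝ} (hg : Continuous g) :
    WeaklyTendsto (fun n => (νs n).map g) (ν.map g) := by
  intro f
  have := h (f.compContinuous ⟨g, hg⟩)
  have e : ∀ μ : Measure ℝ, ∫ t, f t ∂(μ.map g) = ∫ t, f (g t) ∂μ := fun μ =>
    integral_map hg.aemeasurable f.continuous.aestronglyMeasurable
  simp only [e]
  exact this

end WeakLimit

/-! ### Spectral bounds and Chebyshev moments of regular graphs -/

section Regular

open Polynomial Matrix

/-- The Chebyshev moments of the eigenvalue distribution of the transition matrix. -/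
def chebyshevMoment {V : Type*} [Fintype V] [DecidableEq V] (G : SimpleGraph V)
    [DecidableRel G.Adj] (r : ℕ) : ℝ :=
  (aeval (transitionMatrix G) (Chebyshev.T ℝ r)).trace / Fintype.card V

theorem transitionMatrix_isHermitian {V : Type*} [Fintype V] {G : SimpleGraph V}
    [DecidableRel G.Adj] {q : ℕ} (hreg : G.IsRegularOfDegree (q + 1)) :
    (transitionMatrix G).IsHermitian := by
  ext v w
  simp [transitionMatrix, hreg.degree_eq, G.adj_comm]

variable {V : Type*} [Fintype V] [DecidableEq V] {G : SimpleGraph V} [DecidableRel G.Adj]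
  {q : ℕ}

theorem sum_erase_norm_le {M : Matrix V V ℝ} {c : ℝ} (hreg : G.IsRegularOfDegree (q + 1))
    (hM : ∀ v w, v ≠ w → ‖M v w‖ = if G.Adj v w then c else 0) (v : V) :
    ∑ w ∈ Finset.univ.erase v, ‖M v w‖ ≤ (q + 1 : ℕ) * c := by
  rw [Finset.sum_congr rfl fun w hw => hM v w (Finset.ne_of_mem_erase hw).symm,
    Finset.sum_erase _ (by simp), ← Finset.sum_filter, ← SimpleGraph.neighborFinset_eq_filter,
    Finset.sum_const, G.card_neighborFinset_eq_degree, hreg.degree_eq, nsmul_eq_mul]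

theorem abs_eigenvalues_transitionMatrix_le (hreg : G.IsRegularOfDegree (q + 1)) (i : V) :
    |(transitionMatrix_isHermitian hreg).eigenvalues i| ≤ 1 := by
  have h0 : ((q + 1 : ℕ) : ℝ) ≠ 0 := by positivity
  have := norm_eigenvalues_sub_le (transitionMatrix_isHermitian hreg) (c := 0)
    (r := (q + 1 : ℕ) * (1 / (q + 1 : ℕ))) (by simp [transitionMatrix])
    (sum_erase_norm_le hreg fun v w _ => by
      by_cases h : G.Adj v w
      · simp only [transitionMatrix, of_apply, h, if_true, hreg.degree_eq]
        exact Real.norm_of_nonneg (by positivity)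
      · simp [transitionMatrix, h]) i
  rwa [sub_zero, mul_one_div_cancel h0] at this

theorem abs_eigenvalues_lapMatrix_sub_le (hreg : G.IsRegularOfDegree (q + 1)) (i : V) :
    |(G.isHermitian_lapMatrix ℝ).eigenvalues i - (q + 1 : ℕ)| ≤ (q + 1 : ℕ) := by
  have := norm_eigenvalues_sub_le (G.isHermitian_lapMatrix ℝ) (c := (q + 1 : ℕ))
    (r := (q + 1 : ℕ) * 1)
    (by intro k; simp [SimpleGraph.lapMatrix, SimpleGraph.degMatrix, hreg.degree_eq])
    (sum_erase_norm_le hreg fun v w hvw => by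
      by_cases h : G.Adj v w <;> simp [SimpleGraph.lapMatrix, SimpleGraph.degMatrix, hvw, h]) i
  rwa [mul_one] at this

theorem aeval_lapMatrix (hreg : G.IsRegularOfDegree (q + 1)) :
    aeval (G.lapMatrix ℝ) (1 - C ((q + 1 : ℕ) : ℝ)⁻¹ * X) = transitionMatrix G := by
  have h0 : ((q + 1 : ℕ) : ℝ) ≠ 0 := by positivity
  have hdeg : G.degMatrix ℝ = ((q + 1 : ℕ) : ℝ) • (1 : Matrix V V ℝ) := by
    ext v w
    simp [SimpleGraph.degMatrix, diagonal_apply, one_apply, hreg.degree_eq]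
  rw [map_sub, map_one, map_mul, aeval_C, aeval_X, SimpleGraph.lapMatrix, hdeg,
    adjMatrix_eq_smul_transitionMatrix G hreg (Nat.succ_ne_zero q), ← Algebra.smul_def, ← smul_sub,
    smul_smul, inv_mul_cancel₀ h0, one_smul, sub_sub_cancel]

theorem abs_chebyshevMoment_le (hreg : G.IsRegularOfDegree (q + 1)) (r : ℕ) :
    |chebyshevMoment G r| ≤ 1 := by
  rw [chebyshevMoment, trace_aeval (transitionMatrix_isHermitian hreg), abs_div, Nat.abs_cast]
  refine div_le_one_of_le₀ ((Finset.abs_sum_le_sum_abs _ _).trans ?_) (Nat.cast_nonneg _)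
  refine (Finset.sum_le_card_nsmul _ _ 1 fun i _ =>
    Chebyshev.abs_eval_T_real_le_one r (abs_eigenvalues_transitionMatrix_le hreg i)).trans ?_
  simp

theorem zetaTerm_eq (hG : IsVertexTransitive G) (hreg : G.IsRegularOfDegree (q + 1)) (x : V)
    (u : ℂ) : zetaTerm G 1 1 x u = momentTerm q (chebyshevMoment G) u := by
  ext k
  rw [zetaTerm, momentTerm, cycleSum_eq G hG hreg (Nat.succ_ne_zero q), chebyshevMoment]
  push_cast
  ring

end Regular

/-! ### Zeta limits from weakly convergent spectra -/

section WeakZeta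

open Polynomial Matrix

/-- Treats P (g = X) and Δ (g = 1 − X/(q+1)) at once: the pushforward by g of the spectral measure
of M is that of P. -/
theorem tendsto_zeta_of_weaklyTendsto {q : ℕ} {V : ℕ → Type*} [∀ n, Fintype (V n)]
    [∀ n, DecidableEq (V n)] {G : ∀ n, SimpleGraph (V n)} [∀ n, DecidableRel (G n).Adj]
    (htrans : ∀ n, IsVertexTransitive (G n)) (hreg : ∀ n, (G n).IsRegularOfDegree (q + 1))
    (x : ∀ n, V n) {M : ∀ n, Matrix (V n) (V n) ℝ} (hM : ∀ n, (M n).IsHermitian) (g : ℝ[X])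
    (hg : ∀ n, aeval (M n) g = transitionMatrix (G n))
    (hbd : ∀ n i, |g.eval ((hM n).eigenvalues i)| ≤ 1) {μ : Measure ℝ} [IsProbabilityMeasure μ]
    (hμ : WeaklyTendsto (fun n => eigenvalueMeasure (M n)) μ) {u : ℂ} (hu : ‖u‖ < 1) :
    Integrable (fun t => logP u (g.eval t)) μ ∧
      Tendsto (fun n => (zeta (G n) (x n) u)⁻¹) atTop
        (𝓝 ((1 - u ^ 2) ^ (((q : ℂ) - 1) / 2) *
          Complex.exp (∫ t, logP u (g.eval t) ∂μ))) := by
  have hgc : Continuous fun t => g.eval t := g.continuous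
  have hw := hμ.map hgc
  have hprob : IsProbabilityMeasure (μ.map fun t => g.eval t) :=
    Measure.isProbabilityMeasure_map hgc.aemeasurable
  have hae : ∀ n, ∀ᵐ t ∂((eigenvalueMeasure (M n)).map fun t => g.eval t), |t| ≤ 1 := by
    intro n
    rw [ae_map_iff hgc.aemeasurable (measurableSet_le (by fun_prop) (by fun_prop))]
    exact ae_eigenvalueMeasure (hM n) (hbd n) (measurableSet_le (by fun_prop) (by fun_prop))
  have haeμ := ae_abs_le_one_of_weaklyTendsto hw hae
  have hint := integrable_logP hu haeμ
  rw [integrable_map_measure (measurable_logP u).aestronglyMeasurable hgc.aemeasurable] at hint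
  refine ⟨hint, ?_⟩
  have hlim : ∀ r : ℕ, Tendsto (fun n => chebyshevMoment (G n) r) atTop
      (𝓝 (∫ t, (Chebyshev.T ℝ r).eval t ∂(μ.map fun t => g.eval t))) := by
    intro r
    have h := tendsto_integral_of_weaklyTendsto hw hae (Chebyshev.T ℝ r).continuous
    refine h.congr fun n => ?_
    rw [integral_map hgc.aemeasurable (Chebyshev.T ℝ r).continuous.aestronglyMeasurable,
      integral_eigenvalueMeasure (hM n), chebyshevMoment, ← hg n, ← aeval_comp,
      trace_aeval (hM n)]
    simp only [eval_comp]
  have := tendsto_inv_exp_tsum q hu haeμ (fun n => abs_chebyshevMoment_le (hreg n)) hlim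
  rw [integral_map hgc.aemeasurable (measurable_logP u).aestronglyMeasurable] at this
  refine this.congr fun n => ?_
  rw [zeta, abZeta, zetaTerm_eq (htrans n) (hreg n)]

end WeakZeta

/-! ### Closed walks -/

section ClosedWalks

open Polynomial Matrix

/-- The number of closed walks of length `k` at `x`. -/
def closedWalkCount {V : Type*} (G : SimpleGraph V) (x : V) (k : ℕ) : ℕ :=
  Nat.card {p : G.Walk x x // p.length = k}

theorem nonempty_closedWalk_embedding {V W : Type*} {G : SimpleGraph V} {H : SimpleGraph W}
    (φ : G ↪g H) {x : V} {y : W} (h : φ x = y) (k : ℕ) :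
    Nonempty ({p : G.Walk x x // p.length = k} ↪ {p : H.Walk y y // p.length = k}) := by
  subst h
  exact ⟨⟨fun p => ⟨p.1.map φ.toHom, (SimpleGraph.Walk.length_map _ _).trans p.2⟩,
    fun p p' h => Subtype.ext
      (SimpleGraph.Walk.map_injective_of_injective φ.injective _ _ (Subtype.ext_iff.1 h))⟩⟩

/-- Injections in both directions and Schröder–Bernstein. -/
theorem closedWalkCount_iso {V W : Type*} {G : SimpleGraph V} {H : SimpleGraph W} (φ : G ≃g H)
    (x : V) (k : ℕ) : closedWalkCount H (φ x) k = closedWalkCount G x k := by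
  obtain ⟨e₁⟩ := nonempty_closedWalk_embedding φ.toEmbedding (x := x) rfl k
  obtain ⟨e₂⟩ := nonempty_closedWalk_embedding φ.symm.toEmbedding (φ.symm_apply_apply x) k
  obtain ⟨e⟩ := Function.Embedding.antisymm e₂ e₁
  exact Nat.card_congr e

theorem closedWalkCount_induce_ball {V : Type*} (G : SimpleGraph V) (x : V) {k r : ℕ} (hk : k < r)
    (hx : x ∈ G.ball x (r : ℕ∞)) :
    closedWalkCount (G.induce (G.ball x (r : ℕ∞))) ⟨x, hx⟩ k = closedWalkCount G x k := by
  refine Nat.card_congr (Equiv.ofBijective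
    (fun p => ⟨p.1.map (SimpleGraph.Embedding.induce _).toHom,
      (SimpleGraph.Walk.length_map _ _).trans p.2⟩ :
      {p : (G.induce (G.ball x (r : ℕ∞))).Walk ⟨x, hx⟩ ⟨x, hx⟩ // p.length = k} →
        {p : G.Walk x x // p.length = k}) ⟨?_, ?_⟩)
  · intro p p' h
    exact Subtype.ext (SimpleGraph.Walk.map_injective_of_injective
      (SimpleGraph.Embedding.induce (G := G) _).injective _ _ (Subtype.ext_iff.1 h))
  · rintro ⟨p, hp⟩
    have hsupp : ∀ v ∈ p.support, v ∈ G.ball x (r : ℕ∞) := by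
      classical
      intro v hv
      rw [SimpleGraph.ball, Set.mem_ofPred_eq]
      -- The rest of the walk leads from v back to x in at most k < r steps.
      calc G.edist v x ≤ (p.dropUntil v hv).length := SimpleGraph.Walk.edist_le _
        _ ≤ (k : ℕ∞) := by
          rw [← hp]
          exact_mod_cast p.length_dropUntil_le_length hv
        _ < r := by exact_mod_cast hk
    refine ⟨⟨p.induce _ hsupp, ?_⟩, Subtype.ext (SimpleGraph.Walk.map_induce _ _)⟩
    exact (SimpleGraph.Walk.length_map (SimpleGraph.Embedding.induce _).toHom _).symm.trans
      ((congrArg SimpleGraph.Walk.length (SimpleGraph.Walk.map_induce p hsupp)).trans hp)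

theorem BallsIso.closedWalkCount_eq {V W : Type*} {G : SimpleGraph V} {x : V} {H : SimpleGraph W}
    {y : W} {k r : ℕ} (h : BallsIso G x H y r) (hk : k < r) :
    closedWalkCount G x k = closedWalkCount H y k := by
  obtain ⟨φ, hφ⟩ := h
  have hx : x ∈ G.ball x (r : ℕ∞) := by
    rw [SimpleGraph.ball, Set.mem_ofPred_eq, SimpleGraph.edist_self]
    exact_mod_cast (Nat.zero_le k).trans_lt hk
  have hy : y ∈ H.ball y (r : ℕ∞) := by
    rw [SimpleGraph.ball, Set.mem_ofPred_eq, SimpleGraph.edist_self]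
    exact_mod_cast (Nat.zero_le k).trans_lt hk
  have hxy : φ ⟨x, hx⟩ = ⟨y, hy⟩ := Subtype.ext ((hφ _).2 rfl)
  rw [← closedWalkCount_induce_ball G x hk hx, ← closedWalkCount_induce_ball H y hk hy, ← hxy,
    closedWalkCount_iso]

theorem card_finsetWalkLength_eq {V : Type*} [DecidableEq V] (G : SimpleGraph V) [G.LocallyFinite]
    (x : V) (k : ℕ) : (G.finsetWalkLength k x x).card = closedWalkCount G x k := by
  rw [closedWalkCount, Nat.card_eq_fintype_card, ← G.card_set_walk_length_eq]
  rfl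

variable {V : Type*} [Fintype V] [DecidableEq V] {G : SimpleGraph V} [DecidableRel G.Adj] {q : ℕ}

theorem adjMatrix_pow_apply_self (x : V) (k : ℕ) :
    (G.adjMatrix ℝ ^ k) x x = closedWalkCount G x k := by
  rw [G.adjMatrix_pow_apply_eq_card_walk, closedWalkCount, Nat.card_eq_fintype_card]
  rfl

/-- By transitivity the diagonal of each power of the adjacency matrix is constant, so a normalized
trace is the entry at x. -/
theorem chebyshevMoment_eq_sum (hG : IsVertexTransitive G) (hreg : G.IsRegularOfDegree (q + 1))
    (x : V) (r : ℕ) :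
    chebyshevMoment G r = ∑ k ∈ Finset.range ((Chebyshev.T ℝ r).natDegree + 1),
      (Chebyshev.T ℝ r).coeff k * (((q + 1 : ℕ) : ℝ)⁻¹ ^ k * closedWalkCount G x k) := by
  have h0 : ((q + 1 : ℕ) : ℝ) ≠ 0 := by positivity
  have hV : (Fintype.card V : ℝ) ≠ 0 := by
    have : Nonempty V := ⟨x⟩
    exact_mod_cast Fintype.card_ne_zero
  have hP : transitionMatrix G = ((q + 1 : ℕ) : ℝ)⁻¹ • G.adjMatrix ℝ := by
    rw [adjMatrix_eq_smul_transitionMatrix G hreg (Nat.succ_ne_zero q), smul_smul,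
      inv_mul_cancel₀ h0, one_smul]
  have htr : ∀ k, (G.adjMatrix ℝ ^ k).trace = Fintype.card V * closedWalkCount G x k := by
    intro k
    rw [Matrix.trace, Finset.sum_congr rfl fun y _ => ?_, Finset.sum_const, nsmul_eq_mul,
      Finset.card_univ]
    obtain ⟨φ, rfl⟩ := hG x y
    rw [Matrix.diag_apply, adjMatrix_pow_apply_self, closedWalkCount_iso]
  rw [chebyshevMoment, aeval_eq_sum_range, Matrix.trace_sum, Finset.sum_div]
  refine Finset.sum_congr rfl fun k _ => ?_
  rw [hP, _root_.smul_pow, Matrix.trace_smul, Matrix.trace_smul, htr, smul_eq_mul, smul_eq_mul]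
  field_simp

end ClosedWalks

/-! ### Spectral measures of bounded self-adjoint operators -/

section Spectral

open Polynomial

variable {E : Type*} [NormedAddCommGroup E] [InnerProductSpace ℂ E] [CompleteSpace E]
  {T : E →L[ℂ] E} {v : E} {S : Set ℝ}

theorem integral_spectralMeasure (T : E →L[ℂ] E) (v : E) (f : CompactlySupportedContinuousMap ℝ ℝ) :
    ∫ t, f t ∂(spectralMeasure T v) = (inner ℂ v (cfc (fun t : ℝ => f t) T v)).re :=
  RealRMK.integral_rieszMeasure (spectralFunctional T v) f

instance regular_spectralMeasure : (spectralMeasure T v).Regular :=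
  RealRMK.regular_rieszMeasure _

theorem hasCompactSupport_mul_max (f : ℝ → ℝ) (R : ℝ) :
    HasCompactSupport fun t => f t * max 0 (R - |t|) :=
  HasCompactSupport.intro (isCompact_Icc (a := -R) (b := R)) fun t ht => by
    have : R ≤ |t| := by
      by_contra! h
      exact ht ⟨(abs_lt.1 h).1.le, (abs_lt.1 h).2.le⟩
    rw [max_eq_left (by linarith), mul_zero]

/-- The distance to S, cut off to compact support, vanishes on the spectrum, so its functional
calculus and its integral are zero. Letting the cutoff grow forces t ∈ S almost everywhere. -/
theorem ae_mem_of_spectrum_subset (hS : IsClosed S) (hne : S.Nonempty) (hsub : spectrum ℝ T ⊆ S) :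
    ∀ᵐ t ∂(spectralMeasure T v), t ∈ S := by
  have h : ∀ N : ℕ, ∀ᵐ t ∂(spectralMeasure T v),
      Metric.infDist t S * max 0 ((N : ℝ) - |t|) = 0 := by
    intro N
    have hc : Continuous fun t : ℝ => Metric.infDist t S * max 0 ((N : ℝ) - |t|) :=
      (Metric.continuous_infDist_pt S).mul (by fun_prop)
    let f : CompactlySupportedContinuousMap ℝ ℝ := ⟨⟨_, hc⟩, hasCompactSupport_mul_max _ _⟩
    have h0 : ∫ t, f t ∂(spectralMeasure T v) = 0 := by
      have hz : cfc (fun t : ℝ => f t) T = cfc (fun _ : ℝ => (0 : ℝ)) T := by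
        refine cfc_congr fun t ht => ?_
        change Metric.infDist t S * _ = 0
        rw [Metric.infDist_zero_of_mem (hsub ht), zero_mul]
      rw [integral_spectralMeasure, hz]
      simp
    exact (integral_eq_zero_iff_of_nonneg
      (fun t => mul_nonneg Metric.infDist_nonneg (le_max_left _ _))
      (hc.integrable_of_hasCompactSupport (hasCompactSupport_mul_max _ _))).1 h0
  filter_upwards [ae_all_iff.2 h] with t ht
  obtain ⟨N, hN⟩ := exists_nat_gt |t|
  have hpos : 0 < max 0 ((N : ℝ) - |t|) := lt_max_of_lt_right (by linarith)
  exact (hS.mem_iff_infDist_zero hne).2 ((mul_eq_zero.1 (ht N)).resolve_right hpos.ne')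

theorem integral_polynomial_spectralMeasure (hT : IsSelfAdjoint T) (v : E) (p : ℝ[X]) :
    ∫ t, p.eval t ∂(spectralMeasure T v) = (inner ℂ v (aeval T p v)).re := by
  set R : ℝ := ‖T‖ * ‖(1 : E →L[ℂ] E)‖
  have hR0 : 0 ≤ R := by positivity
  have hsub : spectrum ℝ T ⊆ Set.Icc (-R) R := fun t ht =>
    abs_le.1 (spectrum.norm_le_norm_mul_of_mem ht)
  have hae := ae_mem_of_spectrum_subset (v := v) isClosed_Icc ⟨0, by simpa using hR0⟩ hsub
  have hval : ∀ t ∈ Set.Icc (-R) R, p.eval t * min 1 (max 0 (R + 1 - |t|)) = p.eval t := by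
    intro t ht
    have := abs_le.2 ht
    rw [min_eq_left (le_max_of_le_right (by linarith)), mul_one]
  -- The measure is defined by compactly supported functions only, so p is multiplied by a cutoff
  -- equal to 1 on [−R, R], which contains the spectrum.
  let f : CompactlySupportedContinuousMap ℝ ℝ :=
    ⟨⟨fun t => p.eval t * min 1 (max 0 (R + 1 - |t|)), by fun_prop⟩,
      HasCompactSupport.intro (isCompact_Icc (a := -(R + 1)) (b := R + 1)) fun t ht => by
        have : R + 1 ≤ |t| := by
          by_contra! h
          exact ht ⟨(abs_lt.1 h).1.le, (abs_lt.1 h).2.le⟩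
        change p.eval t * min 1 (max 0 (R + 1 - |t|)) = 0
        rw [max_eq_left (by linarith), min_eq_right zero_le_one, mul_zero]⟩
  have h1 : ∫ t, p.eval t ∂(spectralMeasure T v) = ∫ t, f t ∂(spectralMeasure T v) :=
    integral_congr_ae (hae.mono fun t ht => (hval t ht).symm)
  have h2 : cfc (fun t : ℝ => f t) T = aeval T p := by
    rw [← cfc_polynomial p T]
    exact cfc_congr fun t ht => hval t (hsub ht)
  rw [h1, integral_spectralMeasure, h2]

/-- The moment formula for the constant polynomial 1 gives total mass ‖v‖². -/
theorem isProbabilityMeasure_spectralMeasure (hT : IsSelfAdjoint T) (hv : ‖v‖ = 1) :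
    IsProbabilityMeasure (spectralMeasure T v) := by
  set R : ℝ := ‖T‖ * ‖(1 : E →L[ℂ] E)‖
  have hR0 : 0 ≤ R := by positivity
  have hsub : spectrum ℝ T ⊆ Set.Icc (-R) R := fun t ht =>
    abs_le.1 (spectrum.norm_le_norm_mul_of_mem ht)
  have hae := ae_mem_of_spectrum_subset (v := v) isClosed_Icc ⟨0, by simpa using hR0⟩ hsub
  have hfin : IsFiniteMeasure (spectralMeasure T v) := by
    refine ⟨?_⟩
    rw [← measure_congr (eventuallyEq_univ.2 hae)]
    exact isCompact_Icc.measure_lt_top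
  have h1 := integral_polynomial_spectralMeasure hT v 1
  have h2 : (inner ℂ v v).re = (1 : ℝ) := by
    rw [inner_self_eq_norm_sq_to_K, hv]
    simp
  simp only [eval_one, integral_const, smul_eq_mul, mul_one, map_one,
    one_apply_eq_self, h2] at h1
  refine ⟨?_⟩
  rwa [measureReal_def, ENNReal.toReal_eq_one_iff] at h1

end Spectral

/-! ### The adjacency operator on ℓ² and its walk counts -/

section AdjacencyOperator

open Polynomial

variable {W : Type*} {H : SimpleGraph W} [H.LocallyFinite] {d : ℕ} (hd : H.IsRegularOfDegree d)

theorem adjOp_apply (f : L2 W) (v : W) : adjOp H hd f v = ∑ w ∈ H.neighborFinset v, f w := rfl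

open scoped Classical in
theorem delta_apply (y v : W) : delta y v = if v = y then 1 else 0 := by
  rw [delta, lp.single_apply]
  by_cases h : v = y
  · subst h; simp
  · simp [h]

theorem inner_delta (y : W) (f : L2 W) : inner ℂ (delta y) f = f y := by
  classical
  rw [delta, lp.inner_single_left]
  simp

theorem norm_delta (y : W) : ‖delta y‖ = 1 := by
  classical
  rw [delta, lp.norm_single (by simp)]
  simp

theorem adjOp_delta (y : W) : adjOp H hd (delta y) = ∑ w ∈ H.neighborFinset y, delta w := by
  classical
  ext v
  rw [adjOp_apply]
  rw [lp.coeFn_sum, Finset.sum_apply]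
  simp [delta_apply, H.adj_comm]

/-- Pairing with the indicator of v evaluates at v, and the operator sends that indicator to the sum
of those of its neighbours. -/
theorem isSelfAdjoint_adjOp : IsSelfAdjoint (adjOp H hd) := by
  rw [ContinuousLinearMap.isSelfAdjoint_iff']
  ext f v
  rw [← inner_delta, ContinuousLinearMap.adjoint_inner_right, adjOp_delta, sum_inner]
  simp only [inner_delta]
  rfl

theorem norm_adjOp_le : ‖adjOp H hd‖ ≤ d :=
  LinearMap.mkContinuous_norm_le _ (Nat.cast_nonneg d) _

open scoped Classical in
theorem adjOp_pow_delta (y v : W) (k : ℕ) :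
    (adjOp H hd ^ k) (delta y) v = (H.finsetWalkLength k v y).card := by
  induction k generalizing v with
  | zero =>
    rw [pow_zero, one_apply_eq_self, delta_apply]
    by_cases h : v = y
    · subst h; simp [SimpleGraph.finsetWalkLength]
    · simp [SimpleGraph.finsetWalkLength, h]
  | succ k ih =>
    rw [pow_succ', mul_apply_eq_comp, adjOp_apply]
    simp only [ih]
    rw [SimpleGraph.finsetWalkLength, Finset.card_biUnion]
    · simp only [Finset.card_map, Nat.cast_sum]
      exact (Finset.sum_subtype _ (fun w => H.mem_neighborFinset v w)
        fun w => ((H.finsetWalkLength k w y).card : ℂ))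
    · intro a _ b _ hab
      refine Finset.disjoint_left.2 fun p hp hq => ?_
      obtain ⟨p', _, rfl⟩ := Finset.mem_map.1 hp
      obtain ⟨q', _, hq'⟩ := Finset.mem_map.1 hq
      exact hab (Subtype.ext (SimpleGraph.Walk.cons.inj hq').1.symm)

theorem isSelfAdjoint_transitionOp : IsSelfAdjoint (transitionOp H hd) := by
  refine IsSelfAdjoint.smul ?_ (isSelfAdjoint_adjOp hd)
  simp [isSelfAdjoint_iff]

theorem isSelfAdjoint_laplacianOp : IsSelfAdjoint (laplacianOp H hd) := by
  refine IsSelfAdjoint.sub (IsSelfAdjoint.smul ?_ (IsSelfAdjoint.one _)) (isSelfAdjoint_adjOp hd)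
  simp [isSelfAdjoint_iff]

theorem norm_transitionOp_le : ‖transitionOp H hd‖ ≤ 1 := by
  rw [transitionOp, norm_smul, norm_inv, Complex.norm_natCast]
  exact (mul_le_mul_of_nonneg_left (norm_adjOp_le hd) (by positivity)).trans inv_mul_le_one

theorem aeval_laplacianOp (h0 : d ≠ 0) :
    aeval (laplacianOp H hd) (1 - C (d : ℝ)⁻¹ * X) = transitionOp H hd := by
  have h0' : (d : ℂ) ≠ 0 := by exact_mod_cast h0
  ext f v
  have h : aeval (laplacianOp H hd) (1 - C (d : ℝ)⁻¹ * X) =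
      1 - (d : ℝ)⁻¹ • laplacianOp H hd := by
    rw [map_sub, map_one, map_mul, aeval_C, aeval_X, Algebra.smul_def]
  rw [h]
  change f v - (((d : ℝ)⁻¹ : ℝ) : ℂ) * ((d : ℂ) * f v - adjOp H hd f v)
    = (d : ℂ)⁻¹ * adjOp H hd f v
  push_cast
  field_simp
  ring

theorem inner_delta_aeval_transitionOp (y : W) (p : ℝ[X]) :
    (inner ℂ (delta y) (aeval (transitionOp H hd) p (delta y))).re =
      ∑ k ∈ Finset.range (p.natDegree + 1),
        p.coeff k * ((d : ℝ)⁻¹ ^ k * closedWalkCount H y k) := by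
  classical
  rw [aeval_eq_sum_range, sum_apply, inner_sum, Complex.re_sum]
  refine Finset.sum_congr rfl fun k _ => ?_
  rw [transitionOp, _root_.smul_pow, inner_delta]
  change (((p.coeff k : ℂ)) * (((d : ℂ)⁻¹ ^ k) * (adjOp H hd ^ k) (delta y) y)).re = _
  rw [adjOp_pow_delta, card_finsetWalkLength_eq]
  rw [← Complex.ofReal_re (p.coeff k * _)]
  push_cast
  rfl

end AdjacencyOperator

/-! ### Limits of zeta functions along locally convergent sequences -/

section LocalZeta

open Polynomial

theorem LocallyTendsto.eventually_chebyshevMoment_eq {q : ℕ} {V : ℕ → Type*} [∀ n, Fintype (V n)]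
    [∀ n, DecidableEq (V n)] {G : ∀ n, SimpleGraph (V n)} [∀ n, DecidableRel (G n).Adj]
    (htrans : ∀ n, IsVertexTransitive (G n)) (hreg : ∀ n, (G n).IsRegularOfDegree (q + 1))
    {x : ∀ n, V n} {W : Type*} {H : SimpleGraph W} [H.LocallyFinite]
    (hH : H.IsRegularOfDegree (q + 1)) {y : W} (h : LocallyTendsto G x H y) (r : ℕ) :
    ∀ᶠ n in atTop, chebyshevMoment (G n) r =
      (inner ℂ (delta y) (aeval (transitionOp H hH) (Chebyshev.T ℝ r) (delta y))).re := by
  -- Balls are open, so radius one more than the degree is needed to contain every closed walk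
  -- involved.
  filter_upwards [h ((Chebyshev.T ℝ r).natDegree + 1)] with n hn
  rw [chebyshevMoment_eq_sum (htrans n) (hreg n) (x n), inner_delta_aeval_transitionOp]
  refine Finset.sum_congr rfl fun k hk => ?_
  rw [hn.closedWalkCount_eq (Finset.mem_range.1 hk)]

theorem tendsto_zeta_of_locallyTendsto {q : ℕ} {V : ℕ → Type*} [∀ n, Fintype (V n)]
    [∀ n, DecidableEq (V n)] {G : ∀ n, SimpleGraph (V n)} [∀ n, DecidableRel (G n).Adj]
    (htrans : ∀ n, IsVertexTransitive (G n)) (hreg : ∀ n, (G n).IsRegularOfDegree (q + 1))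
    {x : ∀ n, V n} {W : Type*} {H : SimpleGraph W} [H.LocallyFinite]
    (hH : H.IsRegularOfDegree (q + 1)) {y : W} (h : LocallyTendsto G x H y)
    {T : L2 W →L[ℂ] L2 W} (hT : IsSelfAdjoint T) (g : ℝ[X])
    (hg : aeval T g = transitionOp H hH) (hg0 : |g.eval 0| ≤ 1) {u : ℂ} (hu : ‖u‖ < 1) :
    Integrable (fun t => logP u (g.eval t)) (spectralMeasure T (delta y)) ∧
      Tendsto (fun n => (zeta (G n) (x n) u)⁻¹) atTop
        (𝓝 ((1 - u ^ 2) ^ (((q : ℂ) - 1) / 2) *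
          Complex.exp (∫ t, logP u (g.eval t) ∂(spectralMeasure T (delta y))))) := by
  have hgc : Continuous fun t => g.eval t := g.continuous
  have hprob := isProbabilityMeasure_spectralMeasure hT (norm_delta y)
  have hprob' : IsProbabilityMeasure ((spectralMeasure T (delta y)).map fun t => g.eval t) :=
    Measure.isProbabilityMeasure_map hgc.aemeasurable
  have hsub : spectrum ℝ T ⊆ {t | |g.eval t| ≤ 1} := by
    intro t ht
    -- Spectral mapping transfers the norm bound on P to g on the spectrum of T.
    have hmem : g.eval t ∈ spectrum ℝ (transitionOp H hH) :=
      hg ▸ spectrum.subset_polynomial_aeval T g ⟨t, ht, rfl⟩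
    refine (spectrum.norm_le_norm_mul_of_mem hmem).trans ?_
    exact mul_le_one₀ (norm_transitionOp_le hH) (norm_nonneg _) ContinuousLinearMap.norm_id_le
  have hae : ∀ᵐ t ∂((spectralMeasure T (delta y)).map fun t => g.eval t), |t| ≤ 1 := by
    rw [ae_map_iff hgc.aemeasurable (measurableSet_le (by fun_prop) (by fun_prop))]
    -- The point 0 only witnesses nonemptiness, needed because the distance to the empty set is 0 by
    -- convention.
    exact ae_mem_of_spectrum_subset (isClosed_le hgc.abs continuous_const) ⟨0, hg0⟩ hsub
  have hint := integrable_logP hu hae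
  rw [integrable_map_measure (measurable_logP u).aestronglyMeasurable hgc.aemeasurable] at hint
  refine ⟨hint, ?_⟩
  have hlim : ∀ r : ℕ, Tendsto (fun n => chebyshevMoment (G n) r) atTop
      (𝓝 (∫ t, (Chebyshev.T ℝ r).eval t
        ∂((spectralMeasure T (delta y)).map fun t => g.eval t))) := by
    intro r
    refine tendsto_const_nhds.congr' ?_
    filter_upwards [h.eventually_chebyshevMoment_eq htrans hreg hH r] with n hn
    rw [hn, integral_map hgc.aemeasurable (Chebyshev.T ℝ r).continuous.aestronglyMeasurable, ← hg,
      ← aeval_comp]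
    refine Eq.trans ?_ (integral_polynomial_spectralMeasure hT (delta y) _)
    simp only [eval_comp]
  have := tendsto_inv_exp_tsum q hu hae (fun n => abs_chebyshevMoment_le (hreg n)) hlim
  rw [integral_map hgc.aemeasurable (measurable_logP u).aestronglyMeasurable] at this
  refine this.congr fun n => ?_
  rw [zeta, abZeta, zetaTerm_eq (htrans n) (hreg n)]

theorem logDelta_eq (q : ℕ) (u : ℂ) (t : ℝ) :
    logDelta q u t = logP u ((1 - C ((q + 1 : ℕ) : ℝ)⁻¹ * X : ℝ[X]).eval t) := by
  rw [logDelta, logP]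
  congr 1
  simp only [eval_sub, eval_one, eval_mul, eval_C, eval_X]
  push_cast
  ring

end LocalZeta

end GroverZeta

end

/-! ### The limit formulas -/

theorem corollary5 (q : ℕ) (V : ℕ → Type*) [∀ n, Fintype (V n)] [∀ n, DecidableEq (V n)]
    (G : ∀ n, SimpleGraph (V n)) [∀ n, DecidableRel (G n).Adj]
    (htrans : ∀ n, GroverZeta.IsVertexTransitive (G n))
    (hreg : ∀ n, (G n).IsRegularOfDegree (q + 1))
    (hcard : Tendsto (fun n => Fintype.card (V n)) atTop atTop)
    (x : ∀ n, V n) :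
    -- the power series defining the zeta functions converge on the unit disc
    (∀ u : ℂ, ‖u‖ < 1 → ∀ n, Summable (GroverZeta.zetaTerm (G n) 1 1 (x n) u)) ∧
    -- the spectral measures of the transition matrices converge weakly
    (∀ μP : Measure ℝ, IsProbabilityMeasure μP →
      GroverZeta.WeaklyTendsto
        (fun n => GroverZeta.eigenvalueMeasure (GroverZeta.transitionMatrix (G n))) μP →
      ∀ u : ℂ, ‖u‖ < 1 →
        Integrable (GroverZeta.logP u) μP ∧
        Tendsto (fun n => (GroverZeta.zeta (G n) (x n) u)⁻¹) atTop
          (𝓝 ((1 - u ^ 2) ^ (((q : ℂ) - 1) / 2) *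
            Complex.exp (∫ t, GroverZeta.logP u t ∂μP)))) ∧
    -- the spectral measures of the Laplacian matrices converge weakly
    (∀ μΔ : Measure ℝ, IsProbabilityMeasure μΔ →
      GroverZeta.WeaklyTendsto
        (fun n => GroverZeta.eigenvalueMeasure ((G n).lapMatrix ℝ)) μΔ →
      ∀ u : ℂ, ‖u‖ < 1 →
        Integrable (GroverZeta.logDelta q u) μΔ ∧
        Tendsto (fun n => (GroverZeta.zeta (G n) (x n) u)⁻¹) atTop
          (𝓝 ((1 - u ^ 2) ^ (((q : ℂ) - 1) / 2) *
            Complex.exp (∫ t, GroverZeta.logDelta q u t ∂μΔ)))) ∧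
    -- the graphs converge locally to a graph `H`, with spectral measures of operators on `ℓ²`
    (∀ (W : Type*) (H : SimpleGraph W) [H.LocallyFinite] (hH : H.IsRegularOfDegree (q + 1))
      (y : W), GroverZeta.LocallyTendsto G x H y →
      ∀ u : ℂ, ‖u‖ < 1 →
        Integrable (GroverZeta.logP u)
          (GroverZeta.spectralMeasure (GroverZeta.transitionOp H hH) (GroverZeta.delta y)) ∧
        Tendsto (fun n => (GroverZeta.zeta (G n) (x n) u)⁻¹) atTop
          (𝓝 ((1 - u ^ 2) ^ (((q : ℂ) - 1) / 2) *
            Complex.exp (∫ t, GroverZeta.logP u t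
              ∂(GroverZeta.spectralMeasure (GroverZeta.transitionOp H hH)
                (GroverZeta.delta y))))) ∧
        Integrable (GroverZeta.logDelta q u)
          (GroverZeta.spectralMeasure (GroverZeta.laplacianOp H hH) (GroverZeta.delta y)) ∧
        Tendsto (fun n => (GroverZeta.zeta (G n) (x n) u)⁻¹) atTop
          (𝓝 ((1 - u ^ 2) ^ (((q : ℂ) - 1) / 2) *
            Complex.exp (∫ t, GroverZeta.logDelta q u t
              ∂(GroverZeta.spectralMeasure (GroverZeta.laplacianOp H hH)
                (GroverZeta.delta y)))))) := by
  have hX : ∀ (u : ℂ) (t : ℝ), GroverZeta.logP u ((Polynomial.X : Polynomial ℝ).eval t) =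
      GroverZeta.logP u t := fun u t => by rw [Polynomial.eval_X]
  have hL : ∀ u : ℂ, GroverZeta.logDelta q u = fun t => GroverZeta.logP u
      ((1 - Polynomial.C ((q + 1 : ℕ) : ℝ)⁻¹ * Polynomial.X : Polynomial ℝ).eval t) :=
    fun u => funext fun t => GroverZeta.logDelta_eq q u t
  refine ⟨fun u hu n => ?_, fun μP _ hμ u hu => ?_, fun μΔ _ hμ u hu => ?_,
    fun W H _ hH y hloc u hu => ?_⟩
  · rw [GroverZeta.zetaTerm_eq (htrans n) (hreg n)]
    exact GroverZeta.summable_momentTerm (GroverZeta.abs_chebyshevMoment_le (hreg n)) hu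
  · simpa only [hX] using GroverZeta.tendsto_zeta_of_weaklyTendsto htrans hreg x
      (fun n => GroverZeta.transitionMatrix_isHermitian (hreg n)) Polynomial.X
      (fun n => Polynomial.aeval_X _)
      (fun n i => by
        rw [Polynomial.eval_X]
        exact GroverZeta.abs_eigenvalues_transitionMatrix_le (hreg n) i) hμ hu
  · rw [hL]
    refine GroverZeta.tendsto_zeta_of_weaklyTendsto htrans hreg x
      (fun n => (G n).isHermitian_lapMatrix ℝ) _
      (fun n => GroverZeta.aeval_lapMatrix (hreg n)) (fun n i => ?_) hμ hu
    have h0 : (0 : ℝ) < (q + 1 : ℕ) := by positivity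
    have h := GroverZeta.abs_eigenvalues_lapMatrix_sub_le (hreg n) i
    simp only [Polynomial.eval_sub, Polynomial.eval_one, Polynomial.eval_mul, Polynomial.eval_C,
      Polynomial.eval_X]
    -- Writing 1 as (q+1)⁻¹(q+1) on both sides leaves Gershgorin's bound |λ − (q+1)| ≤ q+1.
    rw [abs_sub_comm, ← inv_mul_cancel₀ h0.ne', ← mul_sub, abs_mul,
      abs_of_pos (inv_pos.2 h0)]
    gcongr
  · have hP := GroverZeta.tendsto_zeta_of_locallyTendsto htrans hreg hH hloc
      (GroverZeta.isSelfAdjoint_transitionOp hH) Polynomial.X (Polynomial.aeval_X _) (by simp) hu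
    have hΔ := GroverZeta.tendsto_zeta_of_locallyTendsto htrans hreg hH hloc
      (GroverZeta.isSelfAdjoint_laplacianOp hH) _ (GroverZeta.aeval_laplacianOp hH q.succ_ne_zero)
      (by simp) hu
    simp only [hX] at hP
    rw [hL]
    exact ⟨hP.1, hP.2, hΔ.1, hΔ.2⟩
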